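/- **Arrangements.** A *pseudoline* is the graph of a continuous function $\mathbb R\to\mathbb R$. An *arrangement of $n$ pseudolines* (always simple) is a family of $n$ pseudolines any two of which meet in exactly one point (their *vertex*) and cross there, with no three pseudolines through a common point. The pseudolines are numbered $1,\dots,n$ from top to bottom at the left end ($x\to-\infty$). Two arrangements are *isomorphic* if, for every $i$, the vertices on pseudoline $i$ occur in the same left-to-right order in both. Let $B_n$ be the number of isomorphism classes of arrangements of $n$ pseudolines (so $B_1,\dots,B_6=1,1,2,8,62,908$), and $b_n=\log_2 B_n$. **The hexagonal construction with 6 slopes.** Let $H$ be a regular hexagon with unit sides and a horizontal side. Consider six parallel strips of slopes $0,\infty,\pm1/\sqrt3,\pm\sqrt3$: three bounded by the pairs of lines supporting opposite sides of $H$, three by the pairs of lines supporting opposite short diagonals of $H$. For $n\ge 6$ let $m$ be the odd one of $\lfloor n/6\rfloor$, $\lfloor n/6\rfloor-1$. In each strip take a bundle of $m$ equidistant lines, placed symmetrically to the axis of the strip, at distance (width of the strip)$/m$ from each other, and rotate the whole picture clockwise by a small angle, so that no line is vertical. An arrangement of $n$ pseudolines is *produced by the construction* if $n<6$, or if $n\ge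 6$ and it is obtained as follows: each point of the picture where $i\ge 3$ lines meet is replaced locally by an arbitrary arrangement of $i$ pseudolines ($3\le i\le 6$), the other crossings of lines of distinct bundles being kept; the lines of each bundle are made to cross each other to the right of all their crossings with other bundles, where they form an arrangement of $m$ pseudolines that is itself produced by the construction; and the $n-6m$ remaining pseudolines are added in a fixed position, as the lowest pseudolines at the left end, such that all the vertices on them lie before all the other vertices. (Precisely: whenever $i,j,k$ are distinct, $j>k$, and $i$ or $j$ is a remaining pseudoline, pseudoline $i$ meets $j$ before $k$.) Let $T(n)$ be the number of isomorphism classes of arrangements of $n$ pseudolines produced by the construction. **Theorem.** Let $c=\dfrac{\log_2(256\cdot 62\cdot 908)}{120}$. Then $c>0.1981$, and $$T(n)\ \ge\ 2^{cn^2-O(n\log n)}\qquad (n\ge 2).$$ Moreover $B_n\ge T(n)$ for all $n$; in particular $b_n\ge 0.1981\,n^2$ for all sufficiently large $n$. The same lower bound $2^{cn^2-O(n\log n)}$ holds for the maximum number of arrangements of $n$ pseudolines produced by the construction no two of which can be mapped onto each other (as families of pseudolines, in any order) by a homeomorphism of the plane. -/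

import Mathlib

open Filter

/-- A simple arrangement of `n` pseudolines: `n` graphs of continuous functions `ℝ → ℝ`, any two of
which meet in exactly one point and cross there, no three of them through a common point.
The pseudolines are numbered from top to bottom at the left end (`x → -∞`); every simple
arrangement of `n` pseudolines has exactly one such numbering. -/
structure PseudolineArrangement (n : ℕ) where
  curve : Fin n → ℝ → ℝ
  continuous_curve : ∀ i, Continuous (curve i)
  crossing : ∀ i j, i < j → ∃ x : ℝ, curve i x = curve j x ∧
    (∀ y < x, curve j y < curve i y) ∧ (∀ y > x, curve i y < curve j y)
  simple : ∀ i j k, i < j → j < k → ∀ x : ℝ, ¬ (curve i x = curve j x ∧ curve j x = curve k x)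

namespace PseudolineArrangement

/-- For `j, k ≠ i`: walking along pseudoline `i` from left to right, its vertex with `j` comes
strictly before its vertex with `k`. -/
def Before {n : ℕ} (A : PseudolineArrangement n) (i j k : Fin n) : Prop :=
  ∃ x y : ℝ, x < y ∧ A.curve i x = A.curve j x ∧ A.curve i y = A.curve k y

/-- Isomorphism of arrangements: the order of the vertices along each particular pseudoline
is the same. -/
def Isomorphic {n : ℕ} (A A' : PseudolineArrangement n) : Prop :=
  ∀ i j k : Fin n, i ≠ j → i ≠ k → (A.Before i j k ↔ A'.Before i j k)

/-- Isomorphism as an equivalence relation. -/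
def isoSetoid (n : ℕ) : Setoid (PseudolineArrangement n) where
  r := Isomorphic
  iseqv :=
    { refl := fun _ _ _ _ _ _ => Iff.rfl
      symm := fun h i j k hj hk => (h i j k hj hk).symm
      trans := fun h h' i j k hj hk => (h i j k hj hk).trans (h' i j k hj hk) }

/-- The isomorphism classes of arrangements of `n` pseudolines. -/
def IsoClass (n : ℕ) : Type := Quotient (isoSetoid n)

/-- The isomorphism class of an arrangement. -/
def isoClass {n : ℕ} (A : PseudolineArrangement n) : IsoClass n := Quotient.mk (isoSetoid n) A

/-- The `i`-th pseudoline as a subset of the plane. -/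
def pseudoline {n : ℕ} (A : PseudolineArrangement n) (i : Fin n) : Set (ℝ × ℝ) :=
  {p | p.2 = A.curve i p.1}

/-- Some homeomorphism of the plane maps the one family of pseudolines onto the other one; neither
the numbering, nor the left-to-right direction, nor the orientation of the plane needs to be
preserved. -/
def Homeomorphic {n : ℕ} (A A' : PseudolineArrangement n) : Prop :=
  ∃ (h : (ℝ × ℝ) ≃ₜ (ℝ × ℝ)) (σ : Equiv.Perm (Fin n)),
    ∀ i, h '' A.pseudoline i = A'.pseudoline (σ i)

/-- The subarrangement formed by the pseudolines with numbers `e 0 < e 1 < ⋯ < e (m - 1)`. -/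
def restrict {m n : ℕ} (A : PseudolineArrangement n) (e : Fin m ↪o Fin n) :
    PseudolineArrangement m where
  curve i := A.curve (e i)
  continuous_curve i := A.continuous_curve (e i)
  crossing i j h := A.crossing (e i) (e j) (e.lt_iff_lt.2 h)
  simple i j k h h' := A.simple (e i) (e j) (e k) (e.lt_iff_lt.2 h) (e.lt_iff_lt.2 h')

end PseudolineArrangement

/-- `B n`, the number of nonisomorphic arrangements of `n` pseudolines. -/
noncomputable def numArrangements (n : ℕ) : ℕ := Nat.card (PseudolineArrangement.IsoClass n)

namespace Hexagonal

/-- The number `m` of lines in each bundle: `⌊n/6⌋` or `⌊n/6⌋ - 1`, whichever is odd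
(used for `n ≥ 6` only). -/
def bundleSize (n : ℕ) : ℕ := if Odd (n / 6) then n / 6 else n / 6 - 1

/-- The six strips around the regular hexagon with unit sides, lower left corner at the origin and
lower side on the `x`-axis. Strip `b` lies between the lines
`alpha b * x + beta b * y + gammaLow b = 0` and `alpha b * x + beta b * y + gammaHigh b = 0`.
Its slope is `-√3, -1/√3, 0, 1/√3, √3, ∞` for `b = 0, …, 5`. Strips `0, 2, 4` are bounded by the
lines supporting opposite sides of the hexagon, strips `1, 3, 5` by those supporting opposite short
diagonals. -/
noncomputable def alpha : Fin 6 → ℝ := ![√3, 1, 0, -1, -√3, -1]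

/-- The coefficients of `y`; see `alpha`. -/
noncomputable def beta : Fin 6 → ℝ := ![1, √3, 1, √3, 1, 0]

/-- The constant coefficients of the lower boundary lines; see `alpha`. -/
noncomputable def gammaLow : Fin 6 → ℝ := ![0, -1, 0, 0, √3, 1]

/-- The constant coefficients of the upper boundary lines; see `alpha`. -/
noncomputable def gammaHigh : Fin 6 → ℝ := ![-2 * √3, -3, -√3, -2, -√3, 0]

/-- The `m` equidistant lines of bundle `b`, placed symmetrically to the axis of the strip, at
distance (width of the strip) / `m` from each other. They are numbered by `t = 0, …, m - 1` from top
to bottom (for the vertical bundle: from left to right, which becomes top to bottom under a small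
clockwise rotation). -/
def line (m : ℕ) (b : Fin 6) (t : Fin m) : Set (ℝ × ℝ) :=
  {p | alpha b * p.1 + beta b * p.2 +
    (gammaHigh b + (2 * (t : ℝ) + 1) / (2 * (m : ℝ)) * (gammaLow b - gammaHigh b)) = 0}

/-- `P` is to the left of `Q` after every sufficiently small clockwise rotation of the plane. -/
def LeftOf (P Q : ℝ × ℝ) : Prop := P.1 < Q.1 ∨ (P.1 = Q.1 ∧ P.2 < Q.2)

theorem six_mul_bundleSize_le (n : ℕ) : 6 * bundleSize n ≤ n := by
  unfold bundleSize
  split <;> omega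

/-- The numbering of the `6 * m` lines of the six bundles by slope, from top to bottom within each
bundle: line `t` of bundle `b` gets the number `b * m + t`, where `m = bundleSize n`. -/
def label {n : ℕ} (b : Fin 6) : Fin (bundleSize n) ↪o Fin n :=
  OrderEmbedding.ofStrictMono
    (fun t => ⟨(b : ℕ) * bundleSize n + t, by
      have h := six_mul_bundleSize_le n
      have ht := t.isLt
      have hb : ((b : ℕ) + 1) * bundleSize n ≤ 6 * bundleSize n :=
        Nat.mul_le_mul_right _ b.isLt
      rw [Nat.succ_mul] at hb
      omega⟩)
    (by
      intro s t h
      have : (s : ℕ) < t := h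
      simp only [Fin.mk_lt_mk]
      omega)

/-- `A` arises from the six bundles of `m = bundleSize n` lines each (rotated clockwise by a small
angle) by replacing every multiple crossing locally by an arbitrary simple arrangement of
the pseudolines through it, letting the pseudolines of the same bundle cross each other to the right
of all their crossings with the other bundles, and adding the `n - 6 * m` remaining
pseudolines. -/
structure IsJunction {n : ℕ} (A : PseudolineArrangement n) : Prop where
  /-- Vertices that come from distinct points of the line arrangement keep their order along each
  line; the order of those that come from the same multiple crossing is free. -/
  between : ∀ (b b₁ b₂ : Fin 6), b ≠ b₁ → b ≠ b₂ → ∀ (t t₁ t₂ : Fin (bundleSize n)),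
    ∀ P ∈ line (bundleSize n) b t ∩ line (bundleSize n) b₁ t₁,
    ∀ Q ∈ line (bundleSize n) b t ∩ line (bundleSize n) b₂ t₂,
    LeftOf P Q → A.Before (label b t) (label b₁ t₁) (label b₂ t₂)
  /-- Parallel lines cross to the right of the line arrangement. -/
  within : ∀ (b b₁ : Fin 6), b ≠ b₁ → ∀ (t t' t₁ : Fin (bundleSize n)), t ≠ t' →
    A.Before (label b t) (label b₁ t₁) (label b t')
  /-- The remaining pseudolines are not used in the counting: they have the largest numbers
  and a fixed position, to the left of all the other vertices. -/
  remaining : ∀ i j k : Fin n, i ≠ j → i ≠ k → k < j →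
    (6 * bundleSize n ≤ i ∨ 6 * bundleSize n ≤ j) → A.Before i j k

/-- The arrangements produced by the recursive construction: any arrangement of fewer than six
pseudolines, and for `n ≥ 6` any arrangement as in `IsJunction` whose six bundles are themselves
produced by the construction. -/
inductive IsConstructed : ∀ {n : ℕ}, PseudolineArrangement n → Prop
  | base {n : ℕ} (hn : n < 6) (A : PseudolineArrangement n) : IsConstructed A
  | step {n : ℕ} (hn : 6 ≤ n) (A : PseudolineArrangement n) (hA : IsJunction A)
      (hrec : ∀ b : Fin 6, IsConstructed (A.restrict (label b))) : IsConstructed A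

/-- `T n`, the number of nonisomorphic arrangements of `n` pseudolines in the construction. -/
noncomputable def numConstructed (n : ℕ) : ℕ :=
  (PseudolineArrangement.isoClass '' {A : PseudolineArrangement n | IsConstructed A}).ncard

/-- The constant `c = log₂ (256 · 62 · 908) / 120`. -/
noncomputable def c : ℝ := Real.logb 2 (256 * 62 * 908) / 120

end Hexagonal

/-! ### Consistent triple signs and crossing times. -/

/-- A sequence of four signs with at most one sign change. -/
def MonoSigns (a b c d : Bool) : Prop :=
  (a = c → b = a) ∧ (a = d → b = a) ∧ (a = d → c = a) ∧ (b = d → c = b)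

instance (a b c d : Bool) : Decidable (MonoSigns a b c d) := by
  unfold MonoSigns; infer_instance

/-- Signs of the triples `i < j < k < n` with at most one sign change on every quadruple. -/
def ConsistentSigns (n : ℕ) (χ : ℕ → ℕ → ℕ → Bool) : Prop :=
  ∀ i j k l, i < j → j < k → k < l → l < n →
    MonoSigns (χ i j k) (χ i j l) (χ i k l) (χ j k l)

/-- Times of the crossings of the pairs `i < j < n` which induce the signs `χ`. -/
def CrossingTimes (n : ℕ) (χ : ℕ → ℕ → ℕ → Bool) (g : ℕ → ℕ → ℤ) : Prop :=
  ∀ i j k, i < j → j < k → k < n →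
    (χ i j k = true → g i j < g i k ∧ g i k < g j k) ∧
    (χ i j k = false → g j k < g i k ∧ g i k < g i j)

/-- Induction on the number of pseudolines: the last one is inserted into a gap in time, and every
old crossing is moved before or after this gap as its sign with the last pseudoline demands. -/
theorem ConsistentSigns.exists_crossingTimes {n : ℕ} {χ : ℕ → ℕ → ℕ → Bool}
    (hχ : ConsistentSigns n χ) : ∃ g : ℕ → ℕ → ℤ, CrossingTimes n χ g := by
  induction n with
  | zero => exact ⟨fun _ _ => 0, fun i j k _ _ h => absurd h (Nat.not_lt_zero _)⟩
  | succ n ih =>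
    obtain ⟨g, hg⟩ := ih (fun i j k l h1 h2 h3 h4 => hχ i j k l h1 h2 h3 (by omega))
    obtain ⟨M, hM⟩ : ∃ M : ℤ, ∀ i < n, ∀ j < n, |g i j| ≤ M := by
      refine ⟨∑ i ∈ Finset.range n, ∑ j ∈ Finset.range n, |g i j|, fun i hi j hj => ?_⟩
      calc |g i j| ≤ ∑ j ∈ Finset.range n, |g i j| :=
            Finset.single_le_sum (f := fun j => |g i j|) (fun _ _ => abs_nonneg _)
              (Finset.mem_range.2 hj)
        _ ≤ _ := Finset.single_le_sum (f := fun i => ∑ j ∈ Finset.range n, |g i j|)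
              (fun _ _ => Finset.sum_nonneg fun _ _ => abs_nonneg _) (Finset.mem_range.2 hi)
    -- `B i j` says that pseudoline `n` has to meet `i` before `j`. The last clause of `MonoSigns`
    -- makes this relation transitive, so counting predecessors gives admissible times.
    let B : ℕ → ℕ → Prop := fun i j => (i < j ∧ χ i j n = true) ∨ (j < i ∧ χ j i n = false)
    have Btrans : ∀ i j k, i < n → j < n → k < n → B i j → B j k → B i k := by
      intro i j k hi hj hk hij hjk
      have key : ∀ a b c, a < b → b < c → c < n →
          (χ a b n = χ b c n → χ a c n = χ a b n) := by
        intro a b c h1 h2 h3 h4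
        exact (hχ a b c n h1 h2 h3 (by omega)).2.2.2 h4
      rcases hij with ⟨h1, h2⟩ | ⟨h1, h2⟩ <;> rcases hjk with ⟨h3, h4⟩ | ⟨h3, h4⟩
      · left; exact ⟨by omega, by rw [key i j k h1 h3 hk (by rw [h2, h4]), h2]⟩
      · rcases lt_trichotomy i k with h | h | h
        · left; refine ⟨h, ?_⟩
          by_contra hc
          have := key i k j h h3 hj (by rw [h4]; simpa using hc)
          rw [h2] at this; exact hc this.symm
        · subst h; rw [h2] at h4; exact absurd h4 (by decide)
        · right; refine ⟨h, ?_⟩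
          by_contra hc
          have := key k i j h h1 hj (by rw [h2]; simpa using hc)
          rw [h4] at this; exact hc this.symm
      · rcases lt_trichotomy i k with h | h | h
        · left; refine ⟨h, ?_⟩
          by_contra hc
          have := key j i k h1 h hk (by rw [h2]; symm; simpa using hc)
          rw [h4, h2] at this; exact absurd this (by decide)
        · subst h; rw [h2] at h4; exact absurd h4 (by decide)
        · right; refine ⟨h, ?_⟩
          by_contra hc
          have := key j k i h3 h hi (by rw [h4]; symm; simpa using hc)
          rw [h4, h2] at this; exact absurd this (by decide)
      · right; exact ⟨by omega, by rw [key k j i h3 h1 hi (by rw [h2, h4]), h4]⟩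
    have Birr : ∀ i, ¬ B i i := by
      rintro i (⟨h, _⟩ | ⟨h, _⟩) <;> exact lt_irrefl _ h
    classical
    let rk : ℕ → ℕ := fun i => ((Finset.range n).filter fun j => B j i).card
    have rk_lt : ∀ i j, i < n → j < n → B i j → rk i < rk j := by
      intro i j hi hj hij
      refine Finset.card_lt_card ⟨fun k hk => ?_, fun hsub => ?_⟩
      · simp only [Finset.mem_filter, Finset.mem_range] at hk ⊢
        exact ⟨hk.1, Btrans k i j hk.1 hi hj hk.2 hij⟩
      · have : i ∈ (Finset.range n).filter fun k => B k j := by simp [hi, hij]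
        exact Birr i (Finset.mem_filter.1 (hsub this)).2
    have rk_le : ∀ i, rk i ≤ n := fun i =>
      (Finset.card_filter_le _ _).trans (by simp)
    -- The crossings with the new pseudoline get times in `[0, n]`. Old times lie in `[-M, M]`, so
    -- the shifts move them to at most `-1` or at least `n + 1`; monotonicity of the signs keeps the
    -- old triples in order.
    refine ⟨fun i j => if j = n then (rk i : ℤ) else
      if χ i j n then g i j - (M + 1) else g i j + (M + n + 1), ?_⟩
    intro i j k hij hjk hk
    have hj : j ≠ n := by omega
    have hjn : j < n := by omega
    have hin : i < n := by omega
    rcases Nat.lt_succ_iff_lt_or_eq.1 hk with hkn | rfl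
    · have hk' : k ≠ n := by omega
      have hm := hχ i j k n hij hjk hkn (by omega)
      have h0 := hg i j k hij hjk hkn
      have b1 := abs_le.1 (hM i hin j hjn)
      have b2 := abs_le.1 (hM i hin k hkn)
      have b3 := abs_le.1 (hM j hjn k hkn)
      unfold MonoSigns at hm
      simp only [hj, hk', if_false]
      cases h1 : χ i j k <;> cases h2 : χ i j n <;> cases h3 : χ i k n <;> cases h4 : χ j k n <;>
        simp [h1, h2, h3, h4] at hm h0 ⊢ <;> omega
    · have b1 := abs_le.1 (hM i hin j hjn)
      have r1 := rk_le i
      have r2 := rk_le j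
      simp only [hj, if_false, if_true]
      constructor
      · intro h
        have := rk_lt i j hin hjn (Or.inl ⟨hij, h⟩)
        simp only [h, if_true]
        omega
      · intro h
        have := rk_lt j i hjn hin (Or.inr ⟨hij, h⟩)
        simp only [h]
        simp
        omega

/-! ### Realisation of crossing times by continuous curves. -/

/-- Truncation to the interval `[-1, 1]`. -/
noncomputable def clampUnit (t : ℝ) : ℝ := max (-1) (min 1 t)

theorem continuous_clampUnit : Continuous clampUnit := by
  unfold clampUnit; fun_prop

theorem clampUnit_mono : Monotone clampUnit := by
  intro a b h; unfold clampUnit; gcongr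

theorem clampUnit_of_one_le {t : ℝ} (h : 1 ≤ t) : clampUnit t = 1 := by
  unfold clampUnit; rw [min_eq_left h]; norm_num

theorem clampUnit_of_le_neg_one {t : ℝ} (h : t ≤ -1) : clampUnit t = -1 := by
  unfold clampUnit; rw [max_eq_left]; exact (min_le_right _ _).trans h

theorem clampUnit_pos {t : ℝ} (h : 0 < t) : 0 < clampUnit t := by
  unfold clampUnit; exact lt_max_of_lt_right (lt_min one_pos h)

theorem clampUnit_neg {t : ℝ} (h : t < 0) : clampUnit t < 0 := by
  unfold clampUnit; exact max_lt (by norm_num) (min_lt_of_right_lt h)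

theorem clampUnit_zero : clampUnit 0 = 0 := by
  unfold clampUnit; norm_num

theorem clampUnit_le_one (t : ℝ) : clampUnit t ≤ 1 := by
  unfold clampUnit; exact max_le (by norm_num) (min_le_left _ _)

theorem neg_one_le_clampUnit (t : ℝ) : -1 ≤ clampUnit t := le_max_left _ _

/-- The contribution of pseudoline `j` to the height of pseudoline `i`. -/
noncomputable def crossingStep (g : ℕ → ℕ → ℤ) (i j : ℕ) (x : ℝ) : ℝ :=
  if i < j then clampUnit (g i j - x) else if j < i then clampUnit (x - g j i) else 0

theorem continuous_crossingStep (g : ℕ → ℕ → ℤ) (i j : ℕ) : Continuous (crossingStep g i j) := by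
  unfold crossingStep
  split_ifs
  · exact continuous_clampUnit.comp (by fun_prop)
  · exact continuous_clampUnit.comp (by fun_prop)
  · exact continuous_const

/-- The contributions of a third pseudoline `k` to `i` and `j` are ordered as `i` and `j` themselves
should be. Either the two clamps are translates compared by monotonicity, or one of them is
saturated at `±1`, because distinct integer times differ by at least 1. At time `g i j` both bounds
apply and the contributions agree. -/
theorem CrossingTimes.crossingStep_le {n : ℕ} {χ : ℕ → ℕ → ℕ → Bool} {g : ℕ → ℕ → ℤ}
    (hg : CrossingTimes n χ g) {i j k : ℕ} (hij : i < j) (hj : j < n) (hk : k < n)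
    (hki : k ≠ i) (hkj : k ≠ j) (x : ℝ) :
    (x ≤ g i j → crossingStep g j k x ≤ crossingStep g i k x) ∧
    (g i j ≤ x → crossingStep g i k x ≤ crossingStep g j k x) := by
  have cast_lt : ∀ {a b : ℤ}, a < b → (a : ℝ) + 1 ≤ b := by
    intro a b h; exact_mod_cast h
  unfold crossingStep
  rcases lt_or_gt_of_ne hki with h1 | h1
  · have h2 : k < j := h1.trans hij
    simp only [h1, h2, h1.not_gt, h2.not_gt, if_true, if_false]
    have := hg k i j h1 hij hj
    cases hc : χ k i j
    · obtain ⟨e1, e2⟩ := this.2 hc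
      have e1 := cast_lt e1
      have e2 := cast_lt e2
      constructor
      · intro hx
        rw [clampUnit_of_le_neg_one (by linarith : x - (g k j : ℝ) ≤ -1)]
        exact neg_one_le_clampUnit _
      · intro hx
        exact clampUnit_mono (by linarith)
    · obtain ⟨e1, e2⟩ := this.1 hc
      have e1 := cast_lt e1
      have e2 := cast_lt e2
      constructor
      · intro hx
        exact clampUnit_mono (by linarith)
      · intro hx
        rw [clampUnit_of_one_le (by linarith : 1 ≤ x - (g k j : ℝ))]
        exact clampUnit_le_one _
  · rcases lt_or_gt_of_ne hkj with h2 | h2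
    · simp only [h1, h2, h2.not_gt, if_true, if_false]
      have := hg i k j h1 h2 hj
      cases hc : χ i k j
      · obtain ⟨e1, e2⟩ := this.2 hc
        have e1 := cast_lt e1
        have e2 := cast_lt e2
        constructor
        · intro hx
          rw [clampUnit_of_one_le (by linarith : 1 ≤ (g i k : ℝ) - x)]
          exact clampUnit_le_one _
        · intro hx
          rw [clampUnit_of_one_le (by linarith : 1 ≤ x - (g k j : ℝ))]
          exact clampUnit_le_one _
      · obtain ⟨e1, e2⟩ := this.1 hc
        have e1 := cast_lt e1
        have e2 := cast_lt e2
        constructor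
        · intro hx
          rw [clampUnit_of_le_neg_one (by linarith : x - (g k j : ℝ) ≤ -1)]
          exact neg_one_le_clampUnit _
        · intro hx
          rw [clampUnit_of_le_neg_one (by linarith : (g i k : ℝ) - x ≤ -1)]
          exact neg_one_le_clampUnit _
    · simp only [h1, h2, if_true]
      have := hg i j k hij h2 hk
      cases hc : χ i j k
      · obtain ⟨e1, e2⟩ := this.2 hc
        have e1 := cast_lt e1
        have e2 := cast_lt e2
        constructor
        · intro hx
          exact clampUnit_mono (by linarith)
        · intro hx
          rw [clampUnit_of_le_neg_one (by linarith : (g i k : ℝ) - x ≤ -1)]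
          exact neg_one_le_clampUnit _
      · obtain ⟨e1, e2⟩ := this.1 hc
        have e1 := cast_lt e1
        have e2 := cast_lt e2
        constructor
        · intro hx
          rw [clampUnit_of_one_le (by linarith : 1 ≤ (g i k : ℝ) - x)]
          exact clampUnit_le_one _
        · intro hx
          exact clampUnit_mono (by linarith)

/-- The height of pseudoline `i` at `x`. -/
noncomputable def crossingCurve (n : ℕ) (g : ℕ → ℕ → ℤ) (i : ℕ) (x : ℝ) : ℝ :=
  ∑ j ∈ Finset.range n, crossingStep g i j x

theorem CrossingTimes.curve_lt_of_lt {n : ℕ} {χ : ℕ → ℕ → ℕ → Bool} {g : ℕ → ℕ → ℤ}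
    (hg : CrossingTimes n χ g) {i j : ℕ} (hij : i < j) (hj : j < n) {x : ℝ} (hx : x < g i j) :
    crossingCurve n g j x < crossingCurve n g i x := by
  refine Finset.sum_lt_sum (fun k hk => ?_) ⟨j, Finset.mem_range.2 hj, ?_⟩
  · rcases eq_or_ne k i with rfl | hki
    · simp only [crossingStep, hij, hij.not_gt, lt_irrefl, if_true, if_false]
      exact (clampUnit_neg (by linarith)).le
    rcases eq_or_ne k j with rfl | hkj
    · simp only [crossingStep, hij, lt_irrefl, if_true, if_false]
      exact (clampUnit_pos (by linarith)).le
    exact (hg.crossingStep_le hij hj (Finset.mem_range.1 hk) hki hkj x).1 hx.le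
  · simp only [crossingStep, hij, lt_irrefl, if_true, if_false]
    exact clampUnit_pos (by linarith)

theorem CrossingTimes.curve_lt_of_gt {n : ℕ} {χ : ℕ → ℕ → ℕ → Bool} {g : ℕ → ℕ → ℤ}
    (hg : CrossingTimes n χ g) {i j : ℕ} (hij : i < j) (hj : j < n) {x : ℝ} (hx : g i j < x) :
    crossingCurve n g i x < crossingCurve n g j x := by
  refine Finset.sum_lt_sum (fun k hk => ?_) ⟨j, Finset.mem_range.2 hj, ?_⟩
  · rcases eq_or_ne k i with rfl | hki
    · simp only [crossingStep, hij, hij.not_gt, lt_irrefl, if_true, if_false]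
      exact (clampUnit_pos (by linarith)).le
    rcases eq_or_ne k j with rfl | hkj
    · simp only [crossingStep, hij, lt_irrefl, if_true, if_false]
      exact (clampUnit_neg (by linarith)).le
    exact (hg.crossingStep_le hij hj (Finset.mem_range.1 hk) hki hkj x).2 hx.le
  · simp only [crossingStep, hij, lt_irrefl, if_true, if_false]
    exact clampUnit_neg (by linarith)

theorem CrossingTimes.curve_eq {n : ℕ} {χ : ℕ → ℕ → ℕ → Bool} {g : ℕ → ℕ → ℤ}
    (hg : CrossingTimes n χ g) {i j : ℕ} (hij : i < j) (hj : j < n) :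
    crossingCurve n g i (g i j) = crossingCurve n g j (g i j) := by
  refine Finset.sum_congr rfl fun k hk => ?_
  rcases eq_or_ne k i with rfl | hki
  · simp [crossingStep, hij, hij.not_gt, clampUnit_zero]
  rcases eq_or_ne k j with rfl | hkj
  · simp [crossingStep, hij, clampUnit_zero]
  have := hg.crossingStep_le hij hj (Finset.mem_range.1 hk) hki hkj (g i j)
  exact le_antisymm (this.2 le_rfl) (this.1 le_rfl)

/-- The arrangement with given crossing times. -/
noncomputable def CrossingTimes.arrangement {n : ℕ} {χ : ℕ → ℕ → ℕ → Bool} {g : ℕ → ℕ → ℤ}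
    (hg : CrossingTimes n χ g) : PseudolineArrangement n where
  curve i := crossingCurve n g i
  continuous_curve i := continuous_finsetSum _ fun j _ => continuous_crossingStep g i j
  crossing i j h := ⟨g i j, hg.curve_eq h j.2, fun _ hy => hg.curve_lt_of_lt h j.2 hy,
    fun _ hy => hg.curve_lt_of_gt h j.2 hy⟩
  simple i j k hij hjk x := by
    rintro ⟨h1, h2⟩
    have e1 : x = g i j := by
      rcases lt_trichotomy x (g i j) with h | h | h
      · exact absurd h1 (hg.curve_lt_of_lt hij j.2 h).ne'
      · exact h
      · exact absurd h1 (hg.curve_lt_of_gt hij j.2 h).ne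
    have e2 : x = g j k := by
      rcases lt_trichotomy x (g j k) with h | h | h
      · exact absurd h2 (hg.curve_lt_of_lt hjk k.2 h).ne'
      · exact h
      · exact absurd h2 (hg.curve_lt_of_gt hjk k.2 h).ne
    have e3 : g i j = g j k := by exact_mod_cast e1.symm.trans e2
    have := hg i j k hij hjk k.2
    cases hc : χ i j k
    · have := this.2 hc; omega
    · have := this.1 hc; omega

/-! ### The triple signs of an arrangement and its isomorphism class. -/

namespace PseudolineArrangement

theorem exists_cross {n : ℕ} (A : PseudolineArrangement n) (i j : Fin n) :
    ∃ x : ℝ, i ≠ j → ∀ y, A.curve i y = A.curve j y ↔ y = x := by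
  have key : ∀ i j : Fin n, i < j → ∃ x : ℝ, ∀ y, A.curve i y = A.curve j y ↔ y = x := by
    intro i j h
    obtain ⟨x, h0, h1, h2⟩ := A.crossing i j h
    refine ⟨x, fun y => ⟨fun hy => ?_, fun hy => hy ▸ h0⟩⟩
    rcases lt_trichotomy y x with h | h | h
    · exact absurd hy (h1 y h).ne'
    · exact h
    · exact absurd hy (h2 y h).ne
  rcases lt_trichotomy i j with h | h | h
  · obtain ⟨x, hx⟩ := key i j h
    exact ⟨x, fun _ => hx⟩
  · exact ⟨0, fun h' => absurd h h'⟩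
  · obtain ⟨x, hx⟩ := key j i h
    exact ⟨x, fun _ y => eq_comm.trans (hx y)⟩

/-- The `x`-coordinate of the vertex of two pseudolines. -/
noncomputable def cross {n : ℕ} (A : PseudolineArrangement n) (i j : Fin n) : ℝ :=
  (A.exists_cross i j).choose

theorem curve_eq_iff {n : ℕ} (A : PseudolineArrangement n) {i j : Fin n} (h : i ≠ j) (y : ℝ) :
    A.curve i y = A.curve j y ↔ y = A.cross i j :=
  (A.exists_cross i j).choose_spec h y

theorem cross_comm {n : ℕ} (A : PseudolineArrangement n) {i j : Fin n} (h : i ≠ j) :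
    A.cross i j = A.cross j i :=
  (A.curve_eq_iff h.symm _).1 ((A.curve_eq_iff h _).2 rfl).symm

theorem before_iff {n : ℕ} (A : PseudolineArrangement n) {i j k : Fin n} (hij : i ≠ j)
    (hik : i ≠ k) : A.Before i j k ↔ A.cross i j < A.cross i k := by
  simp only [Before, A.curve_eq_iff hij, A.curve_eq_iff hik]
  exact ⟨fun ⟨x, y, h, hx, hy⟩ => hx ▸ hy ▸ h, fun h => ⟨_, _, h, rfl, rfl⟩⟩

/-- By simplicity, `j` passes strictly above or below the vertex of `i` and `k`. If above, it has
already crossed `i` and not yet `k`; if below, the reverse. -/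
theorem cross_triple {n : ℕ} (A : PseudolineArrangement n) {i j k : Fin n} (hij : i < j)
    (hjk : j < k) :
    (A.cross i j < A.cross i k ∧ A.cross i k < A.cross j k) ∨
    (A.cross j k < A.cross i k ∧ A.cross i k < A.cross i j) := by
  have hik := hij.trans hjk
  obtain ⟨x, x0, x1, x2⟩ := A.crossing i j hij
  obtain ⟨y, y0, y1, y2⟩ := A.crossing j k hjk
  have ex := (A.curve_eq_iff hij.ne x).1 x0
  have ey := (A.curve_eq_iff hjk.ne y).1 y0
  have hz : A.curve i (A.cross i k) = A.curve k (A.cross i k) := (A.curve_eq_iff hik.ne _).2 rfl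
  rw [← ex, ← ey]
  have hs := A.simple i j k hij hjk (A.cross i k)
  generalize A.cross i k = z at hz hs ⊢
  rcases lt_trichotomy x z with h | h | h
  · left
    refine ⟨h, ?_⟩
    by_contra hc
    have h1 := x2 z h
    rcases (not_lt.1 hc).lt_or_eq with h2 | h2
    · have := y2 z h2; linarith
    · subst h2; linarith
  · subst h
    exact absurd ⟨x0, by rw [← x0]; exact hz⟩ hs
  · right
    refine ⟨?_, h⟩
    by_contra hc
    have h1 := x1 z h
    rcases (not_lt.1 hc).lt_or_eq with h2 | h2
    · have := y1 z h2; linarith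
    · subst h2; linarith

/-- The signs of the triples of pseudolines. -/
noncomputable def orient {n : ℕ} (A : PseudolineArrangement n) (i j k : ℕ) : Bool :=
  open Classical in
  if h : i < n ∧ j < n ∧ k < n then
    decide (A.Before ⟨i, h.1⟩ ⟨j, h.2.1⟩ ⟨k, h.2.2⟩) else false

theorem orient_eq_true_iff {n : ℕ} (A : PseudolineArrangement n) (i j k : Fin n) :
    A.orient i j k = true ↔ A.Before i j k := by
  simp [orient]

theorem orient_eq_true {n : ℕ} (A : PseudolineArrangement n) {i j k : Fin n} (hij : i < j)
    (hjk : j < k) :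
    A.orient i j k = true ↔ A.cross i j < A.cross i k ∧ A.cross i k < A.cross j k := by
  rw [orient_eq_true_iff, A.before_iff hij.ne (hij.trans hjk).ne]
  have := A.cross_triple hij hjk
  constructor
  · intro h
    rcases this with h' | h'
    · exact h'
    · exact absurd h h'.2.not_gt
  · exact fun h => h.1

theorem orient_eq_false {n : ℕ} (A : PseudolineArrangement n) {i j k : Fin n} (hij : i < j)
    (hjk : j < k) :
    A.orient i j k = false ↔ A.cross j k < A.cross i k ∧ A.cross i k < A.cross i j := by
  rw [← Bool.not_eq_true, A.orient_eq_true hij hjk]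
  have := A.cross_triple hij hjk
  constructor
  · intro h
    exact this.resolve_left h
  · intro h h'
    exact absurd h.2 h'.1.not_gt

/-- Two sign changes would give a cycle of strict inequalities between the crossing times. -/
theorem consistentSigns_orient {n : ℕ} (A : PseudolineArrangement n) :
    ConsistentSigns n A.orient := by
  intro i j k l hij hjk hkl hl
  have hk : k < n := by omega
  have hj : j < n := by omega
  have hi : i < n := by omega
  lift i to Fin n using hi
  lift j to Fin n using hj
  lift k to Fin n using hk
  lift l to Fin n using hl
  have hij : i < j := hij
  have hjk : j < k := hjk
  have hkl : k < l := hkl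
  have t1 := A.orient_eq_true hij hjk
  have t2 := A.orient_eq_true hij (hjk.trans hkl)
  have t3 := A.orient_eq_true (hij.trans hjk) hkl
  have t4 := A.orient_eq_true hjk hkl
  have f1 := A.orient_eq_false hij hjk
  have f2 := A.orient_eq_false hij (hjk.trans hkl)
  have f3 := A.orient_eq_false (hij.trans hjk) hkl
  have f4 := A.orient_eq_false hjk hkl
  unfold MonoSigns
  cases h1 : A.orient i j k <;> cases h2 : A.orient i j l <;> cases h3 : A.orient i k l <;>
    cases h4 : A.orient j k l <;> simp only [h1, h2, h3, h4, true_iff, false_iff, reduceCtorEq,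
      false_implies, and_self, forall_const] at * <;> exfalso <;> linarith

theorem before_of_orient_eq_true {n : ℕ} (A : PseudolineArrangement n) {i j k : Fin n}
    (hij : i < j) (hjk : j < k) (h : A.orient i j k = true) :
    A.Before i j k ∧ A.Before j i k ∧ A.Before k i j := by
  have hik := hij.trans hjk
  rw [A.before_iff hij.ne hik.ne, A.before_iff hij.ne' hjk.ne, A.before_iff hik.ne' hjk.ne',
    ← A.cross_comm hij.ne, ← A.cross_comm hik.ne, ← A.cross_comm hjk.ne]
  have := (A.orient_eq_true hij hjk).1 h
  exact ⟨this.1, this.1.trans this.2, this.2⟩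

theorem before_of_orient_eq_false {n : ℕ} (A : PseudolineArrangement n) {i j k : Fin n}
    (hij : i < j) (hjk : j < k) (h : A.orient i j k = false) :
    A.Before i k j ∧ A.Before j k i ∧ A.Before k j i := by
  have hik := hij.trans hjk
  rw [A.before_iff hik.ne hij.ne, A.before_iff hjk.ne hij.ne', A.before_iff hjk.ne' hik.ne',
    ← A.cross_comm hij.ne, ← A.cross_comm hik.ne, ← A.cross_comm hjk.ne]
  have := (A.orient_eq_false hij hjk).1 h
  exact ⟨this.2, this.1.trans this.2, this.1⟩

theorem Before.asymm {n : ℕ} {A : PseudolineArrangement n} {i j k : Fin n} (hij : i ≠ j)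
    (hik : i ≠ k) (h : A.Before i j k) : ¬ A.Before i k j := by
  rw [A.before_iff hij hik] at h
  rw [A.before_iff hik hij]
  exact h.not_gt

theorem isomorphic_of_orient {n : ℕ} {A A' : PseudolineArrangement n}
    (h : ∀ i j k : Fin n, i < j → j < k → A.orient i j k = A'.orient i j k) :
    A.Isomorphic A' := by
  have key : ∀ {A A' : PseudolineArrangement n},
      (∀ i j k : Fin n, i < j → j < k → A.orient i j k = A'.orient i j k) →
      ∀ i j k : Fin n, i ≠ j → i ≠ k → A.Before i j k → A'.Before i j k := by
    intro A A' h i j k hij hik hB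
    by_contra hB'
    have hjk : j ≠ k := by
      rintro rfl
      exact Before.asymm hij hik hB hB
    have go : ∀ a b c : Fin n, a < b → b < c →
        (A.Before a b c ∧ A.Before b a c ∧ A.Before c a b ∧
          A'.Before a b c ∧ A'.Before b a c ∧ A'.Before c a b) ∨
        (A.Before a c b ∧ A.Before b c a ∧ A.Before c b a ∧
          A'.Before a c b ∧ A'.Before b c a ∧ A'.Before c b a) := by
      intro a b c hab hbc
      have e := h a b c hab hbc
      cases hc : A.orient a b c
      · have h1 := A.before_of_orient_eq_false hab hbc hc
        have h2 := A'.before_of_orient_eq_false hab hbc (e ▸ hc)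
        tauto
      · have h1 := A.before_of_orient_eq_true hab hbc hc
        have h2 := A'.before_of_orient_eq_true hab hbc (e ▸ hc)
        tauto
    have hn := Before.asymm hij hik hB
    rcases lt_or_gt_of_ne hij with h1 | h1 <;> rcases lt_or_gt_of_ne hik with h2 | h2 <;>
      rcases lt_or_gt_of_ne hjk with h3 | h3
    · have := go i j k h1 h3; tauto
    · have := go i k j h2 h3; tauto
    · exact absurd (h1.trans h3) h2.not_gt
    · have := go k i j h2 h1; tauto
    · have := go j i k h1 h2; tauto
    · exact absurd (h1.trans h2) h3.not_gt
    · have := go j k i h3 h2; tauto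
    · have := go k j i h3 h1; tauto
  intro i j k hij hik
  exact ⟨key h i j k hij hik, key (fun i j k h1 h2 => (h i j k h1 h2).symm) i j k hij hik⟩

theorem Isomorphic.orient_eq {n : ℕ} {A A' : PseudolineArrangement n} (h : A.Isomorphic A')
    {i j k : Fin n} (hij : i < j) (hjk : j < k) : A.orient i j k = A'.orient i j k := by
  rw [Bool.eq_iff_iff, orient_eq_true_iff, orient_eq_true_iff]
  exact h i j k hij.ne (hij.trans hjk).ne

/-- The source of all arrangements constructed below. -/
theorem exists_orient_eq {n : ℕ} {χ : ℕ → ℕ → ℕ → Bool} (hχ : ConsistentSigns n χ) :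
    ∃ A : PseudolineArrangement n, ∀ i j k : Fin n, i < j → j < k →
      A.orient i j k = χ i j k := by
  obtain ⟨g, hg⟩ := hχ.exists_crossingTimes
  refine ⟨hg.arrangement, fun i j k hij hjk => ?_⟩
  have e : ∀ a b : Fin n, a < b → hg.arrangement.cross a b = g a b := fun a b hab =>
    ((hg.arrangement.curve_eq_iff hab.ne _).1 (hg.curve_eq hab b.2)).symm
  have := hg i j k hij hjk k.2
  cases hc : χ i j k
  · rw [hg.arrangement.orient_eq_false hij hjk, e _ _ hij, e _ _ hjk, e _ _ (hij.trans hjk)]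
    exact_mod_cast this.2 hc
  · rw [hg.arrangement.orient_eq_true hij hjk, e _ _ hij, e _ _ hjk, e _ _ (hij.trans hjk)]
    exact_mod_cast this.1 hc

/-- Finiteness matters because `Nat.card` and `Set.ncard` take the value 0 on infinite sets. -/
instance finite_isoClass (n : ℕ) : Finite (IsoClass n) := by
  have : Function.Injective (Quotient.lift (s := isoSetoid n)
      (fun A (i j k : Fin n) => i ≠ j ∧ i ≠ k ∧ A.Before i j k) (by
        intro A A' h
        funext i j k
        exact propext ⟨fun ⟨h1, h2, h3⟩ => ⟨h1, h2, (h i j k h1 h2).1 h3⟩,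
          fun ⟨h1, h2, h3⟩ => ⟨h1, h2, (h i j k h1 h2).2 h3⟩⟩)) := by
    intro q q'
    refine Quotient.inductionOn₂ q q' fun A A' h => Quotient.sound fun i j k hij hik => ?_
    have := congrFun (congrFun (congrFun h i) j) k
    simpa [hij, hik] using this
  exact Finite.of_injective _ this

theorem isoClass_eq_iff {n : ℕ} {A A' : PseudolineArrangement n} :
    isoClass A = isoClass A' ↔ A.Isomorphic A' :=
  Quotient.eq (r := isoSetoid n)

theorem Isomorphic.symm {n : ℕ} {A A' : PseudolineArrangement n} (h : A.Isomorphic A') :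
    A'.Isomorphic A := (isoSetoid n).symm h

theorem Isomorphic.restrict {m n : ℕ} {A A' : PseudolineArrangement n} (h : A.Isomorphic A')
    (e : Fin m ↪o Fin n) : (A.restrict e).Isomorphic (A'.restrict e) := by
  intro i j k hij hik
  exact h (e i) (e j) (e k) (e.injective.ne hij) (e.injective.ne hik)

theorem restrict_orient {m n : ℕ} (A : PseudolineArrangement n) (e : Fin m ↪o Fin n)
    (i j k : Fin m) : (A.restrict e).orient i j k = A.orient (e i) (e j) (e k) := by
  rw [Bool.eq_iff_iff, orient_eq_true_iff, orient_eq_true_iff]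
  rfl

end PseudolineArrangement

namespace Hexagonal

theorem label_ne_label {n : ℕ} {b b₁ : Fin 6} (h : b ≠ b₁) (t t₁ : Fin (bundleSize n)) :
    (label b t : Fin n) ≠ label b₁ t₁ := by
  intro e
  have e : (b : ℕ) * bundleSize n + t = b₁ * bundleSize n + t₁ := congrArg Fin.val e
  have h1 := t.2
  have h2 := t₁.2
  rcases lt_or_gt_of_ne h with h | h
  · have : ((b : ℕ) + 1) * bundleSize n ≤ b₁ * bundleSize n := Nat.mul_le_mul_right _ h
    rw [Nat.succ_mul] at this; omega
  · have : ((b₁ : ℕ) + 1) * bundleSize n ≤ b * bundleSize n := Nat.mul_le_mul_right _ h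
    rw [Nat.succ_mul] at this; omega

theorem IsJunction.of_isomorphic {n : ℕ} {A A' : PseudolineArrangement n} (hA : IsJunction A)
    (h : A.Isomorphic A') : IsJunction A' where
  between b b₁ b₂ h1 h2 t t₁ t₂ P hP Q hQ hPQ :=
    (h _ _ _ (label_ne_label h1 _ _) (label_ne_label h2 _ _)).1
      (hA.between b b₁ b₂ h1 h2 t t₁ t₂ P hP Q hQ hPQ)
  within b b₁ h1 t t' t₁ h2 :=
    (h _ _ _ (label_ne_label h1 _ _) ((label b).injective.ne h2)).1 (hA.within b b₁ h1 t t' t₁ h2)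
  remaining i j k hij hik hkj hr := (h _ _ _ hij hik).1 (hA.remaining i j k hij hik hkj hr)

/-- Being constructed depends on the class only, so representatives may be chosen freely by
`Quotient.out`. -/
theorem IsConstructed.of_isomorphic {n : ℕ} {A A' : PseudolineArrangement n}
    (hA : IsConstructed A) (h : A.Isomorphic A') : IsConstructed A' := by
  induction hA with
  | base hn A => exact .base hn _
  | step hn A hA hrec ih => exact .step hn _ (hA.of_isomorphic h) fun b => ih b (h.restrict _)

/-! ### Determinants of lines and Grassmann–Plücker relations. -/

/-- First coordinates of the normals of the six bundles in lattice coordinates. -/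
def normalA : ℕ → ℤ
  | 0 => 1
  | 1 => 2
  | 2 => 1
  | 3 => 1
  | 4 => 0
  | _ => -1

/-- Second coordinates of the normals of the six bundles in lattice coordinates. -/
def normalB : ℕ → ℤ
  | 0 => 0
  | 1 => 1
  | 2 => 1
  | 3 => 2
  | 4 => 1
  | _ => 1

/-- The determinant of two normals. -/
def wedge (b c : ℕ) : ℤ := normalA b * normalB c - normalA c * normalB b

/-- The determinant of three lines, given by their bundles and their constant coefficients. -/
def lineDet (b₁ : ℕ) (g₁ : ℤ) (b₂ : ℕ) (g₂ : ℤ) (b₃ : ℕ) (g₃ : ℤ) : ℤ :=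
  g₁ * wedge b₂ b₃ - g₂ * wedge b₁ b₃ + g₃ * wedge b₁ b₂

theorem wedge_self (b : ℕ) : wedge b b = 0 := by unfold wedge; ring

theorem wedge_swap (b c : ℕ) : wedge c b = - wedge b c := by unfold wedge; ring

theorem wedge_pos {b c : ℕ} (h : b < c) (hc : c < 6) : 0 < wedge b c := by
  interval_cases c <;> interval_cases b <;> decide

theorem wedge_nonneg {b c : ℕ} (h : b ≤ c) (hc : c < 6) : 0 ≤ wedge b c := by
  rcases h.eq_or_lt with rfl | h
  · rw [wedge_self]
  · exact (wedge_pos h hc).le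

theorem wedge_ne_zero {b c : ℕ} (h : b ≠ c) (hb : b < 6) (hc : c < 6) : wedge b c ≠ 0 := by
  rcases lt_or_gt_of_ne h with h | h
  · exact (wedge_pos h hc).ne'
  · rw [wedge_swap]; exact neg_ne_zero.2 (wedge_pos h hb).ne'

/-- A three-term Grassmann–Plücker relation excludes alternating signs. -/
theorem signs_of_relation {p q r u v w : ℤ} {x y z : Bool} (hu : 0 ≤ u) (hv : 0 ≤ v) (hw : 0 ≤ w)
    (e : p * u - q * v + r * w = 0) (hp : (0 < p → x = true) ∧ (p < 0 → x = false))
    (hq : (0 < q → y = true) ∧ (q < 0 → y = false))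
    (hr : (0 < r → z = true) ∧ (r < 0 → z = false)) :
    (x = z → y = x) ∨ (p * u = 0 ∧ q * v = 0 ∧ r * w = 0) := by
  have nn : ∀ {p u : ℤ} {x : Bool}, 0 ≤ u → ((0 < p → x = true) ∧ (p < 0 → x = false)) →
      (x = true → 0 ≤ p * u) ∧ (x = false → p * u ≤ 0) := by
    intro p u x hu hp
    refine ⟨fun h => mul_nonneg ?_ hu, fun h => mul_nonpos_of_nonpos_of_nonneg ?_ hu⟩
    · by_contra hc
      have := hp.2 (not_le.1 hc); simp_all
    · by_contra hc
      have := hp.1 (not_le.1 hc); simp_all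
  have h1 := nn hu hp
  have h2 := nn hv hq
  have h3 := nn hw hr
  cases x <;> cases y <;> cases z <;>
    simp only [reduceCtorEq, true_implies, false_implies, true_and, and_true, false_or,
      true_or, implies_true] at h1 h2 h3 ⊢ <;> omega

/-- The clauses of `MonoSigns` match the relations `e1` to `e4`, each of which omits one of the four
triples. Their coefficients are wedges of slopes in increasing order, hence nonnegative, so an
alternating pattern forces all three terms to vanish. If some but not all bundles coincide, `neg`
and `pos` give nonzero determinants that exclude this. For four different bundles, three vanishing
determinants force the fourth to vanish, which is the concurrent case `hconc`. -/
theorem monoSigns_of_lineDet {b₁ b₂ b₃ b₄ : ℕ} {g₁ g₂ g₃ g₄ : ℤ} (h12 : b₁ ≤ b₂) (h23 : b₂ ≤ b₃)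
    (h34 : b₃ ≤ b₄) (h4 : b₄ < 6) (g12 : b₁ = b₂ → g₁ < g₂) (g23 : b₂ = b₃ → g₂ < g₃)
    (g34 : b₃ = b₄ → g₃ < g₄) {x y z w : Bool}
    (hx : (0 < lineDet b₁ g₁ b₂ g₂ b₃ g₃ → x = true) ∧ (lineDet b₁ g₁ b₂ g₂ b₃ g₃ < 0 → x = false))
    (hy : (0 < lineDet b₁ g₁ b₂ g₂ b₄ g₄ → y = true) ∧ (lineDet b₁ g₁ b₂ g₂ b₄ g₄ < 0 → y = false))
    (hz : (0 < lineDet b₁ g₁ b₃ g₃ b₄ g₄ → z = true) ∧ (lineDet b₁ g₁ b₃ g₃ b₄ g₄ < 0 → z = false))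
    (hw : (0 < lineDet b₂ g₂ b₃ g₃ b₄ g₄ → w = true) ∧ (lineDet b₂ g₂ b₃ g₃ b₄ g₄ < 0 → w = false))
    (hpar : b₁ = b₄ → MonoSigns x y z w)
    (hconc : b₁ < b₂ → b₂ < b₃ → b₃ < b₄ → lineDet b₁ g₁ b₂ g₂ b₃ g₃ = 0 →
      lineDet b₁ g₁ b₂ g₂ b₄ g₄ = 0 → lineDet b₁ g₁ b₃ g₃ b₄ g₄ = 0 →
      lineDet b₂ g₂ b₃ g₃ b₄ g₄ = 0 → MonoSigns x y z w) : MonoSigns x y z w := by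
  have e1 : lineDet b₁ g₁ b₂ g₂ b₃ g₃ * wedge b₁ b₄ - lineDet b₁ g₁ b₂ g₂ b₄ g₄ * wedge b₁ b₃
      + lineDet b₁ g₁ b₃ g₃ b₄ g₄ * wedge b₁ b₂ = 0 := by unfold lineDet wedge; ring
  have e2 : lineDet b₁ g₁ b₂ g₂ b₃ g₃ * wedge b₂ b₄ - lineDet b₁ g₁ b₂ g₂ b₄ g₄ * wedge b₂ b₃
      + lineDet b₂ g₂ b₃ g₃ b₄ g₄ * wedge b₁ b₂ = 0 := by unfold lineDet wedge; ring
  have e3 : lineDet b₁ g₁ b₂ g₂ b₃ g₃ * wedge b₃ b₄ - lineDet b₁ g₁ b₃ g₃ b₄ g₄ * wedge b₂ b₃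
      + lineDet b₂ g₂ b₃ g₃ b₄ g₄ * wedge b₁ b₃ = 0 := by unfold lineDet wedge; ring
  have e4 : lineDet b₁ g₁ b₂ g₂ b₄ g₄ * wedge b₃ b₄ - lineDet b₁ g₁ b₃ g₃ b₄ g₄ * wedge b₂ b₄
      + lineDet b₂ g₂ b₃ g₃ b₄ g₄ * wedge b₁ b₄ = 0 := by unfold lineDet wedge; ring
  have w12 := wedge_nonneg h12 (by omega)
  have w13 := wedge_nonneg (h12.trans h23) (by omega)
  have w14 := wedge_nonneg (h12.trans (h23.trans h34)) (by omega)
  have w23 := wedge_nonneg h23 (by omega)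
  have w24 := wedge_nonneg (h23.trans h34) (by omega)
  have w34 := wedge_nonneg h34 (by omega)
  have r1 := signs_of_relation w14 w13 w12 e1 hx hy hz
  have r2 := signs_of_relation w24 w23 w12 e2 hx hy hw
  have r3 := signs_of_relation w34 w23 w13 e3 hx hz hw
  have r4 := signs_of_relation w34 w24 w14 e4 hy hz hw
  have neg : ∀ {b c : ℕ} {g g' f : ℤ}, g < g' → b < c → c < 6 → lineDet b g b g' c f < 0 := by
    intro b c g g' f hg hd hd6
    have : lineDet b g b g' c f = -((g' - g) * wedge b c) := by unfold lineDet wedge; ring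
    rw [this]
    exact neg_neg_of_pos (mul_pos (by omega) (wedge_pos hd hd6))
  have pos : ∀ {b c : ℕ} {g g' f : ℤ}, g < g' → b < c → c < 6 → 0 < lineDet b f c g c g' := by
    intro b c g g' f hg hd hd6
    have : lineDet b f c g c g' = (g' - g) * wedge b c := by unfold lineDet wedge; ring
    rw [this]
    exact mul_pos (by omega) (wedge_pos hd hd6)
  unfold MonoSigns at *
  rcases h12.eq_or_lt with a12 | a12 <;> rcases h23.eq_or_lt with a23 | a23 <;>
    rcases h34.eq_or_lt with a34 | a34
  · exact hpar (by omega)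
  · subst a12 a23
    have := hy.2 (neg (g12 rfl) a34 h4)
    have := hz.2 (neg ((g12 rfl).trans (g23 rfl)) a34 h4)
    have := hw.2 (neg (g23 rfl) a34 h4)
    subst y z w; simp
  · subst a12 a34
    have := hx.2 (neg (g12 rfl) a23 h4)
    have := hy.2 (neg (g12 rfl) a23 h4)
    have := hz.1 (pos (g34 rfl) a23 h4)
    have := hw.1 (pos (g34 rfl) a23 h4)
    subst x y z w; simp
  · subst a12
    have d2 := neg (f := g₄) (g12 rfl) (a23.trans a34) h4
    have := hx.2 (neg (g12 rfl) a23 (a34.trans h4))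
    have := hy.2 d2
    have r4 := r4.resolve_right fun h => (mul_neg_of_neg_of_pos d2 (wedge_pos a34 h4)).ne h.1
    subst x y
    revert r4; cases z <;> cases w <;> simp
  · subst a23 a34
    have := hx.1 (pos (g23 rfl) a12 h4)
    have := hy.1 (pos ((g23 rfl).trans (g34 rfl)) a12 h4)
    have := hz.1 (pos (g34 rfl) a12 h4)
    subst x y z; simp
  · subst a23
    have d1 := pos (f := g₁) (g23 rfl) a12 (a34.trans h4)
    have := hx.1 d1
    have := hw.2 (neg (g23 rfl) a34 h4)
    have r1 := r1.resolve_right fun h => (mul_pos d1 (wedge_pos (a12.trans a34) h4)).ne' h.1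
    subst x w
    revert r1; cases y <;> cases z <;> simp
  · subst a34
    have d3 := pos (f := g₁) (g34 rfl) (a12.trans a23) h4
    have := hz.1 d3
    have := hw.1 (pos (g34 rfl) a23 h4)
    have r1 := r1.resolve_right fun h => (mul_pos d3 (wedge_pos a12 (a23.trans h4))).ne' h.2.2
    subst z w
    revert r1; cases x <;> cases y <;> simp
  · have v12 := (wedge_pos a12 (by omega)).ne'
    have v13 := (wedge_pos (a12.trans a23) (by omega)).ne'
    have v14 := (wedge_pos (a12.trans (a23.trans a34)) (by omega)).ne'
    have v23 := (wedge_pos a23 (by omega)).ne'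
    have v24 := (wedge_pos (a23.trans a34) (by omega)).ne'
    have v34 := (wedge_pos a34 (by omega)).ne'
    simp only [mul_eq_zero, v12, v13, v14, v23, v24, v34, or_false] at r1 r2 r3 r4
    have hc := hconc a12 a23 a34
    rcases r1 with r1 | ⟨z1, z2, z3⟩
    · rcases r2 with r2 | ⟨z1, z2, z4⟩
      · rcases r3 with r3 | ⟨z1, z3, z4⟩
        · rcases r4 with r4 | ⟨z2, z3, z4⟩
          · exact ⟨r1, r2, r3, r4⟩
          · refine hc ?_ z2 z3 z4
            simpa [z2, z3, z4, v14] using e1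
        · refine hc z1 ?_ z3 z4
          simpa [z1, z3, z4, v13] using e1
      · refine hc z1 z2 ?_ z4
        simpa [z1, z2, z4, v12] using e1
    · refine hc z1 z2 z3 ?_
      simpa [z1, z2, z3, v12] using e2

/-! ### The signs of the hexagonal construction. -/

/-- Position of the triple `a < b < c` among all triples. -/
def tripleIndex (a b c : ℕ) : ℕ := 19 - (c * (c - 1) * (c - 2) / 6 + b * (b - 1) / 2 + a)

/-- The value of the linear form of bundle `b` at a point. -/
def normalForm (b : ℕ) (P : ℤ × ℤ) : ℤ := normalA b * P.1 + normalB b * P.2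

/-- Some line of bundle `b` passes through `P / 3`. -/
def OnBundle (h b : ℕ) (P : ℤ × ℤ) : Prop :=
  3 ∣ normalForm b P ∧ |normalForm b P| ≤ 3 * h

/-- The line with number `i` passes through `P / 3`. -/
def Through (h : ℕ) (P : ℤ × ℤ) (i : ℕ) : Prop :=
  normalForm (i / (2 * h + 1)) P + 3 * ((i % (2 * h + 1) : ℕ) - h : ℤ) = 0

theorem Through.onBundle {h : ℕ} {P : ℤ × ℤ} {i : ℕ} (hP : Through h P i) :
    OnBundle h (i / (2 * h + 1)) P := by
  unfold Through at hP
  unfold OnBundle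
  have := Nat.mod_lt i (show 0 < 2 * h + 1 by omega)
  generalize normalForm (i / (2 * h + 1)) P = v at *
  generalize i % (2 * h + 1) = t at *
  refine ⟨by omega, abs_le.2 ⟨by omega, by omega⟩⟩

/-- The determinant of three lines, given by their numbers. -/
def indexDet (h i j k : ℕ) : ℤ :=
  lineDet (i / (2 * h + 1)) ((i % (2 * h + 1) : ℕ) - h) (j / (2 * h + 1))
    ((j % (2 * h + 1) : ℕ) - h) (k / (2 * h + 1)) ((k % (2 * h + 1) : ℕ) - h)

theorem Through.of_indexDet {h : ℕ} {P : ℤ × ℤ} {i j k : ℕ} (hi : Through h P i)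
    (hj : Through h P j) (hD : indexDet h i j k = 0)
    (hw : wedge (i / (2 * h + 1)) (j / (2 * h + 1)) ≠ 0) : Through h P k := by
  unfold Through normalForm at *
  unfold indexDet lineDet at hD
  refine (mul_eq_zero.1 ?_).resolve_left hw
  unfold wedge at *
  linear_combination 3 * hD - (normalA (j / (2 * h + 1)) * normalB (k / (2 * h + 1)) -
    normalA (k / (2 * h + 1)) * normalB (j / (2 * h + 1))) * hi +
    (normalA (i / (2 * h + 1)) * normalB (k / (2 * h + 1)) -
    normalA (k / (2 * h + 1)) * normalB (i / (2 * h + 1))) * hj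

theorem Through.unique {h : ℕ} {P Q : ℤ × ℤ} {i j : ℕ} (hi : Through h P i)
    (hj : Through h P j) (hi' : Through h Q i) (hj' : Through h Q j)
    (hw : wedge (i / (2 * h + 1)) (j / (2 * h + 1)) ≠ 0) : P = Q := by
  unfold Through normalForm at *
  unfold wedge at hw
  ext
  · refine sub_eq_zero.1 ((mul_eq_zero.1 ?_).resolve_left hw)
    linear_combination normalB (j / (2 * h + 1)) * (hi - hi') -
      normalB (i / (2 * h + 1)) * (hj - hj')
  · refine sub_eq_zero.1 ((mul_eq_zero.1 ?_).resolve_left hw)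
    linear_combination normalA (i / (2 * h + 1)) * (hj - hj') -
      normalA (j / (2 * h + 1)) * (hi - hi')

/-- The signs of the arrangement with local choices `ψ` at the points `pts` and with bundles of
signs `ω`. -/
noncomputable def junctionSigns (h : ℕ) (pts : Finset (ℤ × ℤ)) (ψ : ℤ × ℤ → ℕ) (ω : ℕ → ℕ → ℕ → ℕ → Bool)
    (i j k : ℕ) : Bool :=
  open Classical in
  if 6 * (2 * h + 1) ≤ k then false
  else if i / (2 * h + 1) = k / (2 * h + 1) then
    ω (i / (2 * h + 1)) (i % (2 * h + 1)) (j % (2 * h + 1)) (k % (2 * h + 1))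
  else if indexDet h i j k = 0 then
    decide (∃ P ∈ pts, Through h P i ∧ Through h P j ∧ Through h P k ∧
      (ψ P).testBit (tripleIndex (i / (2 * h + 1)) (j / (2 * h + 1)) (k / (2 * h + 1))) = true)
  else decide (0 < indexDet h i j k)

/-- Two lines of different slopes meet only once, so the point in the definition can only be `P`. -/
theorem junctionSigns_of_through {h : ℕ} {pts : Finset (ℤ × ℤ)} {ψ : ℤ × ℤ → ℕ}
    {ω : ℕ → ℕ → ℕ → ℕ → Bool} {i j k : ℕ} (hk : k < 6 * (2 * h + 1))
    (hij : i / (2 * h + 1) < j / (2 * h + 1)) (hjk : j / (2 * h + 1) < k / (2 * h + 1))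
    {P : ℤ × ℤ} (hP : P ∈ pts) (hi : Through h P i) (hj : Through h P j) (hk' : Through h P k) :
    junctionSigns h pts ψ ω i j k =
      (ψ P).testBit (tripleIndex (i / (2 * h + 1)) (j / (2 * h + 1)) (k / (2 * h + 1))) := by
  classical
  have hb : k / (2 * h + 1) < 6 := (Nat.div_lt_iff_lt_mul (by omega)).2 hk
  have hw := wedge_pos hij (hjk.trans hb)
  have hD : indexDet h i j k = 0 := by
    unfold Through normalForm at hi hj hk'
    unfold indexDet lineDet
    have : (3 : ℤ) ≠ 0 := by norm_num
    refine (mul_eq_zero.1 ?_).resolve_left this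
    unfold wedge
    linear_combination (normalA (j / (2 * h + 1)) * normalB (k / (2 * h + 1)) -
      normalA (k / (2 * h + 1)) * normalB (j / (2 * h + 1))) * hi -
      (normalA (i / (2 * h + 1)) * normalB (k / (2 * h + 1)) -
      normalA (k / (2 * h + 1)) * normalB (i / (2 * h + 1))) * hj +
      (normalA (i / (2 * h + 1)) * normalB (j / (2 * h + 1)) -
      normalA (j / (2 * h + 1)) * normalB (i / (2 * h + 1))) * hk'
  unfold junctionSigns
  rw [if_neg (by omega), if_neg (by omega), if_pos hD]
  rw [Bool.eq_iff_iff, decide_eq_true_iff]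
  constructor
  · rintro ⟨Q, hQ, h1, h2, h3, h4⟩
    rwa [Through.unique h1 h2 hi hj hw.ne'] at h4
  · exact fun h4 => ⟨P, hP, hi, hj, hk', h4⟩

theorem consistentSigns_junctionSigns {n h : ℕ} {pts : Finset (ℤ × ℤ)} {ψ : ℤ × ℤ → ℕ}
    {ω : ℕ → ℕ → ℕ → ℕ → Bool}
    (hψ : ∀ P ∈ pts, ∀ a b c d, a < b → b < c → c < d → d < 6 → OnBundle h a P → OnBundle h b P →
      OnBundle h c P → OnBundle h d P → MonoSigns ((ψ P).testBit (tripleIndex a b c))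
        ((ψ P).testBit (tripleIndex a b d)) ((ψ P).testBit (tripleIndex a c d))
        ((ψ P).testBit (tripleIndex b c d)))
    (hω : ∀ b < 6, ConsistentSigns (2 * h + 1) (ω b)) :
    ConsistentSigns n (junctionSigns h pts ψ ω) := by
  intro i j k l hij hjk hkl _
  rcases le_or_gt (6 * (2 * h + 1)) l with hl | hl
  · have : ∀ a b, junctionSigns h pts ψ ω a b l = false := fun a b => by
      unfold junctionSigns; rw [if_pos hl]
    -- The last three of the four signs are false, which leaves room for one change at most.
    rw [this, this, this]
    unfold MonoSigns; simp
  have mono : ∀ {a b : ℕ}, a ≤ b → a / (2 * h + 1) ≤ b / (2 * h + 1) :=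
    fun h => Nat.div_le_div_right h
  have hb : l / (2 * h + 1) < 6 := (Nat.div_lt_iff_lt_mul (by omega)).2 hl
  have same : ∀ {a b : ℕ}, a < b → a / (2 * h + 1) = b / (2 * h + 1) →
      a % (2 * h + 1) < b % (2 * h + 1) := by
    intro a b hab e
    have h1 := Nat.div_add_mod a (2 * h + 1)
    have h2 := Nat.div_add_mod b (2 * h + 1)
    rw [e] at h1
    omega
  have samez : ∀ {a b : ℕ}, a < b → a / (2 * h + 1) = b / (2 * h + 1) →
      ((a % (2 * h + 1) : ℕ) - h : ℤ) < (b % (2 * h + 1) : ℕ) - h := by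
    intro a b hab e
    have := same hab e
    omega
  have sgn : ∀ {a b c : ℕ}, a < b → b < c → c ≤ l →
      (0 < indexDet h a b c → junctionSigns h pts ψ ω a b c = true) ∧
      (indexDet h a b c < 0 → junctionSigns h pts ψ ω a b c = false) := by
    intro a b c hab hbc hcl
    unfold junctionSigns
    rw [if_neg (by omega)]
    split_ifs with h1 h2
    · have h1' : a / (2 * h + 1) = b / (2 * h + 1) :=
        le_antisymm (mono hab.le) (h1 ▸ mono hbc.le)
      have : indexDet h a b c = 0 := by
        unfold indexDet; rw [← h1, ← h1']; unfold lineDet; rw [wedge_self]; ring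
      rw [this]; simp
    · rw [h2]; simp
    · constructor
      · intro h3; simpa using h3
      · intro h3; simpa using h3.le
  refine monoSigns_of_lineDet (mono hij.le) (mono hjk.le) (mono hkl.le) hb (samez hij) (samez hjk)
    (samez hkl) (sgn hij hjk hkl.le) (sgn hij (hjk.trans hkl) le_rfl) (sgn (hij.trans hjk) hkl le_rfl)
    (sgn hjk hkl le_rfl) ?_ ?_
  · intro e
    have e1 : i / (2 * h + 1) = j / (2 * h + 1) :=
      le_antisymm (mono hij.le) (e ▸ mono (hjk.trans hkl).le)
    have e2 : i / (2 * h + 1) = k / (2 * h + 1) :=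
      le_antisymm (mono (hij.trans hjk).le) (e ▸ mono hkl.le)
    have : ∀ {a b c : ℕ}, a / (2 * h + 1) = i / (2 * h + 1) → c / (2 * h + 1) = i / (2 * h + 1) →
        c ≤ l → junctionSigns h pts ψ ω a b c =
          ω (i / (2 * h + 1)) (a % (2 * h + 1)) (b % (2 * h + 1)) (c % (2 * h + 1)) := by
      intro a b c h1 h2 h3
      unfold junctionSigns
      rw [if_neg (by omega), if_pos (h1.trans h2.symm), h1]
    rw [this rfl e2.symm hkl.le, this rfl e.symm le_rfl, this rfl e.symm le_rfl,
      this e1.symm e.symm le_rfl]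
    exact hω _ (e ▸ hb) _ _ _ _ (same hij e1) (same hjk (e1 ▸ e2)) (same hkl (e2 ▸ e))
      (Nat.mod_lt _ (by omega))
  · intro a1 a2 a3 d1 d2 d3 d4
    change indexDet h i j k = 0 at d1
    change indexDet h i j l = 0 at d2
    change indexDet h i k l = 0 at d3
    change indexDet h j k l = 0 at d4
    by_cases hP : ∃ P ∈ pts, Through h P i ∧ Through h P j ∧ Through h P k ∧ Through h P l
    · obtain ⟨P, hP, t1, t2, t3, t4⟩ := hP
      rw [junctionSigns_of_through (hkl.trans hl) a1 a2 hP t1 t2 t3,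
        junctionSigns_of_through hl a1 (a2.trans a3) hP t1 t2 t4,
        junctionSigns_of_through hl (a1.trans a2) a3 hP t1 t3 t4,
        junctionSigns_of_through hl a2 a3 hP t2 t3 t4]
      exact hψ P hP _ _ _ _ a1 a2 a3 hb t1.onBundle t2.onBundle t3.onBundle t4.onBundle
    -- If the common point is not in `pts`, all four signs take the default value false: a point of
    -- `pts` on three of these lines would lie on the fourth as well.
    · have no : ∀ {a b c : ℕ}, c ≤ l → a / (2 * h + 1) ≠ c / (2 * h + 1) → indexDet h a b c = 0 →
          (∀ P, Through h P a → Through h P b → Through h P c →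
            Through h P i ∧ Through h P j ∧ Through h P k ∧ Through h P l) →
          junctionSigns h pts ψ ω a b c = false := by
        intro a b c hc hne hD hall
        unfold junctionSigns
        classical
        rw [if_neg (by omega), if_neg hne, if_pos hD, decide_eq_false_iff_not]
        rintro ⟨P, hPp, t1, t2, t3, _⟩
        exact hP ⟨P, hPp, hall P t1 t2 t3⟩
      have v12 := (wedge_pos a1 (by omega)).ne'
      have v13 := (wedge_pos (a1.trans a2) (by omega)).ne'
      have v23 := (wedge_pos a2 (by omega)).ne'
      have perm : ∀ a b c, indexDet h b c a = indexDet h a b c := by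
        intro a b c; unfold indexDet lineDet wedge; ring
      have perm' : ∀ a b c, indexDet h a c b = - indexDet h a b c := by
        intro a b c; unfold indexDet lineDet wedge; ring
      rw [no hkl.le (by omega) d1 fun P t1 t2 t3 => ⟨t1, t2, t3, t1.of_indexDet t2 d2 v12⟩,
        no le_rfl (by omega) d2 fun P t1 t2 t4 => ⟨t1, t2, t1.of_indexDet t2 d1 v12, t4⟩,
        no le_rfl (by omega) d3 fun P t1 t3 t4 =>
          ⟨t1, t1.of_indexDet t3 (by rw [perm', d1, neg_zero]) v13, t3, t4⟩,
        no le_rfl (by omega) d4 fun P t2 t3 t4 =>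
          ⟨t2.of_indexDet t3 (by rw [perm, d1]) v23, t2, t3, t4⟩]
      unfold MonoSigns; simp

/-! ### From the hexagon to the lattice, and verification of the junction conditions. -/

/-- First lattice coordinate of a point of the plane. -/
noncomputable def latticeFst (m : ℕ) (p : ℝ × ℝ) : ℝ := m * (p.1 + p.2 / √3 - 1) / 2

/-- Second lattice coordinate of a point of the plane. -/
noncomputable def latticeSnd (m : ℕ) (p : ℝ × ℝ) : ℝ := m * (p.2 / √3 - p.1) / 2

/-- For odd `m = 2 * h + 1` the middle line of each bundle is the axis of its strip, and the offsets
`t - h` are integers. Writing `y = √3 * Y` removes the irrational coefficients. -/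
theorem lattice_eq_of_mem_line {h : ℕ} {m : ℕ} (hm : m = 2 * h + 1) {b : Fin 6} {t : Fin m}
    {p : ℝ × ℝ} (hp : p ∈ line m b t) :
    normalA b * latticeFst m p + normalB b * latticeSnd m p + ((t : ℝ) - h) = 0 := by
  have h3 : √3 * √3 = (3 : ℝ) := Real.mul_self_sqrt (by norm_num)
  have h0 : √3 ≠ 0 := by positivity
  have hm0 : (m : ℝ) ≠ 0 := by rw [hm]; positivity
  have hh : (h : ℝ) = (m - 1) / 2 := by rw [hm]; push_cast; ring
  obtain ⟨x, y⟩ := p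
  obtain ⟨Y, rfl⟩ : ∃ Y, y = √3 * Y := ⟨y / √3, by field_simp⟩
  unfold latticeFst latticeSnd
  rw [hh]
  simp only [line, Set.mem_ofPred_eq] at hp
  have key : ∀ {u c : ℝ}, c ≠ 0 → c * u = 0 → u = 0 := fun hc h => (mul_eq_zero.1 h).resolve_left hc
  have hY : √3 * Y / √3 = Y := by field_simp
  simp only [hY]
  generalize ((t : ℕ) : ℝ) = t at *
  fin_cases b <;>
    simp [alpha, beta, gammaLow, gammaHigh, normalA, normalB] at hp ⊢ <;> field_simp at hp ⊢
  · refine sub_eq_zero.1 (key h0 ?_)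
    linear_combination hp
  · linear_combination hp / 2 - m * Y * h3
  · refine sub_eq_zero.1 (key h0 ?_)
    linear_combination hp
  · linear_combination hp - m * Y * h3
  · refine sub_eq_zero.1 (key h0 ?_)
    linear_combination hp / 2
  · linear_combination hp

/-- The vector `(normalB b, -normalA b)` points along the bundle to the right. For the vertical
bundle it points upwards, as the tie-break in `LeftOf` requires. -/
theorem exists_pos_of_leftOf {m : ℕ} (hm : 0 < m) {b : Fin 6} {γ : ℝ} {P Q : ℝ × ℝ}
    (hP : normalA b * latticeFst m P + normalB b * latticeSnd m P + γ = 0)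
    (hQ : normalA b * latticeFst m Q + normalB b * latticeSnd m Q + γ = 0) (h : LeftOf P Q) :
    ∃ l : ℝ, 0 < l ∧ latticeFst m Q = latticeFst m P + l * normalB b ∧
      latticeSnd m Q = latticeSnd m P - l * normalA b := by
  have hm0 : (0 : ℝ) < m := by exact_mod_cast hm
  have h3 : (0 : ℝ) < √3 := by positivity
  have d1 : (latticeFst m Q - latticeSnd m Q) - (latticeFst m P - latticeSnd m P)
      = m * (Q.1 - P.1) := by unfold latticeFst latticeSnd; ring
  have d2 : (latticeFst m Q + latticeSnd m Q) - (latticeFst m P + latticeSnd m P)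
      = m * ((Q.2 - P.2) / √3) := by unfold latticeFst latticeSnd; ring
  have hl : 0 < (latticeFst m Q - latticeSnd m Q) - (latticeFst m P - latticeSnd m P) ∨
      ((latticeFst m Q - latticeSnd m Q) - (latticeFst m P - latticeSnd m P) = 0 ∧
        0 < (latticeFst m Q + latticeSnd m Q) - (latticeFst m P + latticeSnd m P)) := by
    rw [d1, d2]
    rcases h with h | ⟨h, h'⟩
    · left; exact mul_pos hm0 (by linarith)
    · right; exact ⟨by rw [h]; ring, mul_pos hm0 (div_pos (by linarith) h3)⟩
  generalize latticeFst m P = s at *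
  generalize latticeFst m Q = s' at *
  generalize latticeSnd m P = r at *
  generalize latticeSnd m Q = r' at *
  clear d1 d2
  fin_cases b <;> simp [normalA, normalB] at hP hQ ⊢
  · exact ⟨r - r', by rcases hl with hl | hl <;> linarith, by linarith, by linarith⟩
  · exact ⟨s' - s, by rcases hl with hl | hl <;> linarith, by linarith, by linarith⟩
  · exact ⟨s' - s, by rcases hl with hl | hl <;> linarith, by linarith, by linarith⟩
  · exact ⟨r - r', by rcases hl with hl | hl <;> linarith, by linarith, by linarith⟩
  · exact ⟨s' - s, by rcases hl with hl | hl <;> linarith, by linarith, by linarith⟩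
  · exact ⟨s' - s, by rcases hl with hl | hl <;> linarith, by linarith, by linarith⟩

/-- Along line `i`, the displacement from the vertex with `j` to the vertex with `k` is the
determinant divided by the product of the two wedges. Both change sign suitably under permutations,
which reduces all cases to sorted triples. -/
theorem before_of_indexDet {n h : ℕ} {pts : Finset (ℤ × ℤ)} {ψ : ℤ × ℤ → ℕ}
    {ω : ℕ → ℕ → ℕ → ℕ → Bool} {A : PseudolineArrangement n}
    (hA : ∀ i j k : Fin n, i < j → j < k → A.orient i j k = junctionSigns h pts ψ ω i j k)
    {i j k : Fin n} (hi : (i : ℕ) < 6 * (2 * h + 1)) (hj : (j : ℕ) < 6 * (2 * h + 1))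
    (hk : (k : ℕ) < 6 * (2 * h + 1))
    (hd : 0 < indexDet h i j k * (wedge (i / (2 * h + 1)) (j / (2 * h + 1)) *
      wedge (i / (2 * h + 1)) (k / (2 * h + 1)))) : A.Before i j k := by
  have hb : ∀ {a : ℕ}, a < 6 * (2 * h + 1) → a / (2 * h + 1) < 6 := fun h =>
    (Nat.div_lt_iff_lt_mul (by omega)).2 h
  have w : ∀ {a b : Fin n}, a < b → (b : ℕ) < 6 * (2 * h + 1) →
      0 ≤ wedge (a / (2 * h + 1)) (b / (2 * h + 1)) := fun hab hb' =>
    wedge_nonneg (Nat.div_le_div_right (Fin.lt_def.1 hab).le) (hb hb')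
  have swap1 : ∀ a b c, indexDet h b a c = - indexDet h a b c := by
    intro a b c; unfold indexDet lineDet wedge; ring
  have swap2 : ∀ a b c, indexDet h a c b = - indexDet h a b c := by
    intro a b c; unfold indexDet lineDet wedge; ring
  have sgn : ∀ {a b c : Fin n}, a < b → b < c → (c : ℕ) < 6 * (2 * h + 1) →
      (0 < indexDet h a b c → A.orient a b c = true) ∧
      (indexDet h a b c < 0 → A.orient a b c = false) := by
    intro a b c hab hbc hc
    have hab' := Nat.div_le_div_right (c := 2 * h + 1) (Fin.lt_def.1 hab).le
    have hbc' := Nat.div_le_div_right (c := 2 * h + 1) (Fin.lt_def.1 hbc).le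
    rw [hA a b c hab hbc]
    unfold junctionSigns
    rw [if_neg (by omega)]
    split_ifs with h1 h2
    · have h1' : (a : ℕ) / (2 * h + 1) = b / (2 * h + 1) := le_antisymm hab' (h1 ▸ hbc')
      have : indexDet h a b c = 0 := by
        unfold indexDet; rw [← h1, ← h1']; unfold lineDet; rw [wedge_self]; ring
      rw [this]; simp
    · rw [h2]; simp
    · exact ⟨fun h3 => by simpa using h3, fun h3 => by simpa using h3.le⟩
  have pos : ∀ {d u v : ℤ}, 0 ≤ u → 0 ≤ v → 0 < d * (u * v) → 0 < d := fun hu hv hd =>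
    pos_of_mul_pos_left hd (mul_nonneg hu hv)
  rcases lt_trichotomy i j with h1 | h1 | h1
  · rcases lt_trichotomy i k with h2 | h2 | h2
    · have hd := pos (w h1 hj) (w h2 hk) hd
      rcases lt_trichotomy j k with h3 | h3 | h3
      · exact (A.before_of_orient_eq_true h1 h3 ((sgn h1 h3 hk).1 hd)).1
      · exfalso; subst h3
        have := swap2 i j j; omega
      · refine (A.before_of_orient_eq_false h2 h3 ((sgn h2 h3 hj).2 ?_)).1
        rw [swap2]; omega
    · exfalso; subst h2; rw [wedge_self] at hd; simp at hd
    · refine (A.before_of_orient_eq_false h2 h1 ((sgn h2 h1 hj).2 ?_)).2.1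
      rw [wedge_swap (k / (2 * h + 1))] at hd
      have := pos (d := -indexDet h i j k) (w h1 hj) (w h2 hi) (by linarith)
      rw [swap1 i k j, swap2 i j k]; omega
  · exfalso; subst h1; rw [wedge_self] at hd; simp at hd
  · rw [wedge_swap (j / (2 * h + 1))] at hd
    rcases lt_trichotomy i k with h2 | h2 | h2
    · refine (A.before_of_orient_eq_true h1 h2 ((sgn h1 h2 hk).1 ?_)).2.1
      have := pos (d := -indexDet h i j k) (w h1 hi) (w h2 hk) (by linarith)
      rw [swap1 i j k]; omega
    · exfalso; subst h2; rw [wedge_self] at hd; simp at hd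
    · rw [wedge_swap (k / (2 * h + 1))] at hd
      have hd := pos (d := indexDet h i j k) (w h1 hi) (w h2 hi) (by linarith)
      rcases lt_trichotomy j k with h3 | h3 | h3
      · refine (A.before_of_orient_eq_true h3 h2 ((sgn h3 h2 hi).1 ?_)).2.2
        rw [swap2 j i k, swap1 i j k]; omega
      · exfalso; subst h3
        have := swap2 i j j; omega
      · refine (A.before_of_orient_eq_false h3 h1 ((sgn h3 h1 hi).2 ?_)).2.2
        rw [swap1 j k i, swap2 j i k, swap1 i j k]; omega

theorem isJunction_of_orient {n h : ℕ} (hm : bundleSize n = 2 * h + 1) {pts : Finset (ℤ × ℤ)}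
    {ψ : ℤ × ℤ → ℕ} {ω : ℕ → ℕ → ℕ → ℕ → Bool} {A : PseudolineArrangement n}
    (hA : ∀ i j k : Fin n, i < j → j < k → A.orient i j k = junctionSigns h pts ψ ω i j k) :
    IsJunction A := by
  have val : ∀ (b : Fin 6) (t : Fin (bundleSize n)),
      ((label b t : Fin n) : ℕ) = b * (2 * h + 1) + t := by
    intro b t; rw [← hm]; rfl
  have tlt : ∀ t : Fin (bundleSize n), (t : ℕ) < 2 * h + 1 := fun t => hm ▸ t.2
  have lt : ∀ (b : Fin 6) (t : Fin (bundleSize n)),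
      ((label b t : Fin n) : ℕ) < 6 * (2 * h + 1) := by
    intro b t
    have h1 : ((b : ℕ) + 1) * (2 * h + 1) ≤ 6 * (2 * h + 1) := Nat.mul_le_mul_right _ b.2
    have := tlt t
    rw [add_one_mul] at h1
    rw [val]
    omega
  have hdiv : ∀ (b : Fin 6) (t : Fin (bundleSize n)),
      ((label b t : Fin n) : ℕ) / (2 * h + 1) = b := by
    intro b t
    rw [val, mul_comm, Nat.mul_add_div (by omega), Nat.div_eq_of_lt (tlt t), add_zero]
  have hmod : ∀ (b : Fin 6) (t : Fin (bundleSize n)),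
      ((label b t : Fin n) : ℕ) % (2 * h + 1) = t := by
    intro b t
    rw [val, mul_comm, Nat.mul_add_mod, Nat.mod_eq_of_lt (tlt t)]
  have wne : ∀ {b b' : Fin 6}, b ≠ b' → wedge b b' ≠ 0 := fun {b b'} hb =>
    wedge_ne_zero (fun h => hb (Fin.ext h)) b.2 b'.2
  refine ⟨?_, ?_, ?_⟩
  · intro b b₁ b₂ h1 h2 t t₁ t₂ P hP Q hQ hPQ
    refine before_of_indexDet hA (lt _ _) (lt _ _) (lt _ _) ?_
    unfold indexDet
    rw [hdiv, hdiv, hdiv, hmod, hmod, hmod]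
    have p0 := lattice_eq_of_mem_line hm hP.1
    have p1 := lattice_eq_of_mem_line hm hP.2
    have q0 := lattice_eq_of_mem_line hm hQ.1
    have q2 := lattice_eq_of_mem_line hm hQ.2
    obtain ⟨l, hl, e1, e2⟩ := exists_pos_of_leftOf (by omega) p0 q0 hPQ
    have key : ((lineDet b ((t : ℕ) - h) b₁ ((t₁ : ℕ) - h) b₂ ((t₂ : ℕ) - h) : ℤ) : ℝ)
        = l * ((wedge b b₁ * wedge b b₂ : ℤ) : ℝ) := by
      unfold lineDet wedge
      push_cast
      rw [e1, e2] at q2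
      linear_combination (normalA b₁ * normalB b₂ - normalA b₂ * normalB b₁) * p0 -
        (normalA b * normalB b₂ - normalA b₂ * normalB b) * p1 +
        (normalA b * normalB b₁ - normalA b₁ * normalB b) * q2
    have : (0 : ℝ) < ((lineDet b ((t : ℕ) - h) b₁ ((t₁ : ℕ) - h) b₂ ((t₂ : ℕ) - h) *
        (wedge b b₁ * wedge b b₂) : ℤ) : ℝ) := by
      rw [Int.cast_mul, key, mul_assoc]
      refine mul_pos hl (mul_self_pos.2 ?_)
      exact_mod_cast mul_ne_zero (wne h1) (wne h2)
    exact_mod_cast this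
  · intro b b₁ h1 t t' t₁ ht
    have ht' : (t : ℕ) ≠ t' := fun h => ht (Fin.ext h)
    have hw := wne h1
    have key : ∀ i j k : Fin n, i < j → j < k → (k : ℕ) < 6 * (2 * h + 1) →
        (i : ℕ) / (2 * h + 1) ≠ k / (2 * h + 1) →
        (0 < indexDet h i j k → A.orient i j k = true) ∧
        (indexDet h i j k < 0 → A.orient i j k = false) := by
      intro i j k hij hjk hk hne
      rw [hA i j k hij hjk]
      unfold junctionSigns
      rw [if_neg (by omega), if_neg hne]
      split_ifs with h2
      · rw [h2]; simp
      · exact ⟨fun h3 => by simpa using h3, fun h3 => by simpa using h3.le⟩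
    have hlt : ∀ {b c : Fin 6} (s u : Fin (bundleSize n)), b < c →
        (label b s : Fin n) < label c u := by
      intro b c s u hbc
      have h1 : ((b : ℕ) + 1) * (2 * h + 1) ≤ c * (2 * h + 1) := Nat.mul_le_mul_right _ hbc
      have := tlt s
      rw [add_one_mul] at h1
      rw [Fin.lt_def, val, val]
      omega
    -- The sign is false if the other bundle comes later and true if it comes earlier; in both cases
    -- the vertex of the two parallels is the last of the three.
    have par : ∀ s u : Fin (bundleSize n), s < u →
        A.Before (label b s) (label b₁ t₁) (label b u) ∧
        A.Before (label b u) (label b₁ t₁) (label b s) := by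
      intro s u hsu
      have hsu' : (label b s : Fin n) < label b u := (label b).lt_iff_lt.2 hsu
      have hz : (0 : ℤ) < (u : ℕ) - (s : ℕ) := by have := Fin.lt_def.1 hsu; omega
      rcases lt_or_gt_of_ne h1 with hb | hb
      · have := (key _ _ _ hsu' (hlt u t₁ hb) (lt _ _) (by
          rw [hdiv, hdiv]; exact (Fin.lt_def.1 hb).ne)).2 (by
            unfold indexDet lineDet
            rw [hdiv, hdiv, hdiv, hmod, hmod, hmod, wedge_self]
            have := mul_pos hz (wedge_pos (Fin.lt_def.1 hb) b₁.2)
            linarith)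
        have := A.before_of_orient_eq_false hsu' (hlt u t₁ hb) this
        exact ⟨this.1, this.2.1⟩
      · have := (key _ _ _ (hlt t₁ s hb) hsu' (lt _ _) (by
          rw [hdiv, hdiv]; exact (Fin.lt_def.1 hb).ne)).1 (by
            unfold indexDet lineDet
            rw [hdiv, hdiv, hdiv, hmod, hmod, hmod, wedge_self]
            have := mul_pos hz (wedge_pos (Fin.lt_def.1 hb) b.2)
            linarith)
        have := A.before_of_orient_eq_true (hlt t₁ s hb) hsu' this
        exact ⟨this.2.1, this.2.2⟩
    rcases lt_or_gt_of_ne ht with h2 | h2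
    · exact (par t t' h2).1
    · exact (par t' t h2).2
  · intro i j k hij hik hkj hr
    rw [hm] at hr
    have key : ∀ a b c : Fin n, a < b → b < c → 6 * (2 * h + 1) ≤ (c : ℕ) →
        A.orient a b c = false := by
      intro a b c hab hbc hc
      rw [hA a b c hab hbc]
      unfold junctionSigns
      rw [if_pos hc]
    rcases lt_or_gt_of_ne hik with h1 | h1
    · have := Fin.lt_def.1 h1
      have := Fin.lt_def.1 hkj
      exact (A.before_of_orient_eq_false h1 hkj (key _ _ _ h1 hkj (by omega))).1
    · rcases lt_or_gt_of_ne hij with h2 | h2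
      · have := Fin.lt_def.1 h2
        exact (A.before_of_orient_eq_false h1 h2 (key _ _ _ h1 h2 (by omega))).2.1
      · have := Fin.lt_def.1 h2
        exact (A.before_of_orient_eq_false hkj h2 (key _ _ _ hkj h2 (by omega))).2.2

/-! ### Enumeration of the local choices at a multiple crossing. -/

/-- For every triple of bundles: its bit set, the bit of its sign, and for every quadruple in which
it consists of the last three elements the bit set of the quadruple, the bits of the signs, and
the consistent values. -/
def signTable : List (ℕ × ℕ × List (ℕ × ℕ × List ℕ)) :=
  [(7, 524288, []),
    (11, 262144, []),
    (13, 131072, []),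
    (14, 65536, [(15, 983040, [0, 524288, 786432, 917504, 983040, 458752, 196608, 65536])]),
    (19, 32768, []),
    (21, 16384, []),
    (22, 8192, [(23, 581632, [0, 524288, 557056, 573440, 581632, 57344, 24576, 8192])]),
    (25, 4096, []),
    (26, 2048, [(27, 301056, [0, 262144, 294912, 299008, 301056, 38912, 6144, 2048])]),
    (28, 1024, [(29, 152576, [0, 131072, 147456, 151552, 152576, 21504, 5120, 1024]),
      (30, 76800, [0, 65536, 73728, 75776, 76800, 11264, 3072, 1024])]),
    (35, 512, []),
    (37, 256, []),
    (38, 128, [(39, 525184, [0, 524288, 524800, 525056, 525184, 896, 384, 128])]),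
    (41, 64, []),
    (42, 32, [(43, 262752, [0, 262144, 262656, 262720, 262752, 608, 96, 32])]),
    (44, 16, [(45, 131408, [0, 131072, 131328, 131392, 131408, 336, 80, 16]),
      (46, 65712, [0, 65536, 65664, 65696, 65712, 176, 48, 16])]),
    (49, 8, []),
    (50, 4, [(51, 33292, [0, 32768, 33280, 33288, 33292, 524, 12, 4])]),
    (52, 2, [(53, 16650, [0, 16384, 16640, 16648, 16650, 266, 10, 2]),
      (54, 8326, [0, 8192, 8320, 8324, 8326, 134, 6, 2])]),
    (56, 1, [(57, 4169, [0, 4096, 4160, 4168, 4169, 73, 9, 1]),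
      (58, 2085, [0, 2048, 2080, 2084, 2085, 37, 5, 1]),
      (60, 1043, [0, 1024, 1040, 1042, 1043, 19, 3, 1])])]

/-- Universal quantification over a list. -/
def allMembers {α : Type} (l : List α) (p : α → Bool) : Bool :=
  List.rec true (fun x _ ih => Bool.rec false ih (p x)) l

/-- Consistency of the signs `x` on a quadruple, if it is contained in `S`. -/
def checkQuadruple (S x : ℕ) (q : ℕ × ℕ × List ℕ) : Bool :=
  Bool.rec true (List.rec false (fun v _ ih => Bool.rec ih true (Nat.beq (Nat.land x q.2.1) v)) q.2.2)
    (Nat.beq (Nat.land S q.1) q.1)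

/-- Evaluation of a natural number before its use. -/
def withNat {α : Type} (x : ℕ) (f : ℕ → α) : α :=
  Nat.rec (f 0) (fun k _ => f (Nat.succ k)) x

theorem withNat_eq {α : Type} (x : ℕ) (f : ℕ → α) : withNat x f = f x := by
  cases x <;> rfl

/-- Prepending an element with a property. -/
def consIf (p : ℕ → Bool) (x : ℕ) (l : List ℕ) : List ℕ := Bool.rec l (x :: l) (p x)

/-- All consistent extensions of the sign vectors in `l` by the signs in `t`. -/
def extendSigns (S : ℕ) (t : List (ℕ × ℕ × List (ℕ × ℕ × List ℕ))) (l : List ℕ) : List ℕ :=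
  List.rec (motive := fun _ => List ℕ → List ℕ) (fun l => l) (fun r _ ih l =>
    Bool.rec (ih l) (ih (List.rec [] (fun x _ m => withNat x fun x =>
      consIf (fun x => allMembers r.2.2 (checkQuadruple S x)) x
        (withNat (Nat.add x r.2.1) fun x =>
          consIf (fun x => allMembers r.2.2 (checkQuadruple S x)) x m)) l))
      (Nat.beq (Nat.land S r.1) r.1)) t l

/-- All consistent sign vectors on the elements of the bit set `S`. -/
def localSigns (S : ℕ) : List ℕ := extendSigns S signTable [0]

/-- The bits of the triples contained in `S`. -/
def tripleBits (S : ℕ) : ℕ :=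
  (signTable.map fun r => if Nat.beq (Nat.land S r.1) r.1 then r.2.1 else 0).sum

/-- A test for strictly increasing order. -/
def increasingList (x : ℕ) (l : List ℕ) : Bool :=
  List.rec (motive := fun _ => ℕ → Bool) (fun _ => true)
    (fun y _ ih x => Bool.rec false (ih y) (Nat.blt x y)) l x

/-- Consistency, fitness and distinctness of the vectors in `localSigns S`. -/
def localSignsCheck (S : ℕ) : Bool :=
  withNat (tripleBits S) fun T =>
  (allMembers (localSigns S) fun x => Nat.beq (Nat.land x T) x &&
    (allMembers signTable fun r => allMembers r.2.2 (checkQuadruple S x))) &&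
  increasingList 0 ((localSigns S).map Nat.succ) && !(localSigns S).isEmpty

theorem allMembers_eq {α : Type} (l : List α) (p : α → Bool) : allMembers l p = l.all p := by
  induction l with
  | nil => rfl
  | cons x l ih =>
    change (Bool.rec false (allMembers l p) (p x) : Bool) = _
    rw [ih, List.all_cons]
    cases p x <;> rfl

theorem checkQuadruple_eq (S x : ℕ) (q : ℕ × ℕ × List ℕ) :
    checkQuadruple S x q =
      (!(Nat.beq (Nat.land S q.1) q.1) || q.2.2.any fun v => Nat.beq (Nat.land x q.2.1) v) := by
  obtain ⟨B, M, l⟩ := q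
  unfold checkQuadruple
  cases Nat.beq (Nat.land S B) B
  · rfl
  · simp only [Bool.not_true, Bool.false_or]
    induction l with
    | nil => rfl
    | cons v l ih =>
      simp only [List.any_cons]
      cases Nat.beq (Nat.land x M) v
      · exact ih
      · rfl

theorem increasingList.nodup {l : List ℕ} : ∀ {x : ℕ}, increasingList x l = true →
    l.Nodup ∧ ∀ y ∈ l, x < y := by
  induction l with
  | nil => exact fun _ => ⟨List.nodup_nil, by simp⟩
  | cons y l ih =>
    intro x h
    have h : (Bool.rec false (increasingList y l) (Nat.blt x y) : Bool) = true := h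
    cases hxy : Nat.blt x y <;> rw [hxy] at h
    · exact absurd h Bool.false_ne_true
    · have ih := ih h
      rw [Nat.blt_eq] at hxy
      refine ⟨List.nodup_cons.2 ⟨fun hy => lt_irrefl _ (ih.2 y hy), ih.1⟩, fun z hz => ?_⟩
      rcases List.mem_cons.1 hz with rfl | hz
      · exact hxy
      · exact hxy.trans (ih.2 z hz)

/-- The lower bound needs consistency and distinctness of the listed vectors, not exhaustiveness.
Since `tripleIndex` gives earlier triples higher bits, the enumeration is increasing and
distinctness becomes a linear test; the shift by `Nat.succ` lets the zero vector pass the initial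
comparison with 0. -/
theorem localSignsCheck_eq_true : ∀ S < 64, localSignsCheck S = true := by decide +kernel

theorem length_localSigns_all : (localSigns 63).length = 908 := by decide +kernel

theorem length_localSigns_five :
    (localSigns 61).length = 62 ∧ (localSigns 55).length = 62 ∧ (localSigns 31).length = 62 := by
  decide +kernel

theorem length_localSigns_four :
    (localSigns 23).length = 8 ∧ (localSigns 29).length = 8 ∧ (localSigns 53).length = 8 := by
  decide +kernel

theorem length_localSigns_three :
    (localSigns 42).length = 2 ∧ (localSigns 49).length = 2 ∧ (localSigns 7).length = 2 ∧
      (localSigns 28).length = 2 := by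
  decide +kernel

set_option synthInstance.maxSize 2000 in
set_option synthInstance.maxHeartbeats 400000 in
-- Certifies the numerals of `signTable`: each quadruple occurs, its mask covers its four triples,
-- and its listed values are monotone.
theorem exists_mem_signTable : ∀ d < 6, ∀ c < d, ∀ b < c, ∀ a < b,
    ∃ r ∈ signTable, ∃ q ∈ r.2.2, q.1 = 2 ^ a + 2 ^ b + 2 ^ c + 2 ^ d ∧
      (∀ v ∈ q.2.2, MonoSigns (v.testBit (tripleIndex a b c)) (v.testBit (tripleIndex a b d))
        (v.testBit (tripleIndex a c d)) (v.testBit (tripleIndex b c d))) ∧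
      q.2.1.testBit (tripleIndex a b c) = true ∧ q.2.1.testBit (tripleIndex a b d) = true ∧
      q.2.1.testBit (tripleIndex a c d) = true ∧ q.2.1.testBit (tripleIndex b c d) = true := by
  decide +kernel

set_option synthInstance.maxSize 2000 in
set_option synthInstance.maxHeartbeats 400000 in
theorem land_quadruple : ∀ S < 64, ∀ d < 6, ∀ c < d, ∀ b < c, ∀ a < b,
    S.testBit a = true → S.testBit b = true → S.testBit c = true → S.testBit d = true →
      Nat.land S (2 ^ a + 2 ^ b + 2 ^ c + 2 ^ d) = 2 ^ a + 2 ^ b + 2 ^ c + 2 ^ d := by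
  decide +kernel

theorem exists_of_testBit_tripleBits : ∀ S < 64, tripleBits S < 2 ^ 20 ∧
    ∀ i < 20, (tripleBits S).testBit i = true → ∃ c, c < 6 ∧ ∃ b, b < c ∧ ∃ a, a < b ∧
      S.testBit a = true ∧ S.testBit b = true ∧ S.testBit c = true ∧ i = tripleIndex a b c := by
  decide +kernel

theorem localSigns_nodup {S : ℕ} (hS : S < 64) : (localSigns S).Nodup := by
  have := localSignsCheck_eq_true S hS
  simp only [localSignsCheck, withNat_eq, Bool.and_eq_true] at this
  exact (increasingList.nodup this.1.2).1.of_map _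

theorem localSigns_ne_nil {S : ℕ} (hS : S < 64) : localSigns S ≠ [] := by
  have := localSignsCheck_eq_true S hS
  simp only [localSignsCheck, withNat_eq, Bool.and_eq_true] at this
  simpa using this.2

theorem monoSigns_of_mem_localSigns {S x a b c d : ℕ} (hS : S < 64) (hx : x ∈ localSigns S)
    (hab : a < b) (hbc : b < c) (hcd : c < d) (hd : d < 6) (ha : S.testBit a = true)
    (hb : S.testBit b = true) (hc : S.testBit c = true) (hd' : S.testBit d = true) :
    MonoSigns (x.testBit (tripleIndex a b c)) (x.testBit (tripleIndex a b d))
      (x.testBit (tripleIndex a c d)) (x.testBit (tripleIndex b c d)) := by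
  have := localSignsCheck_eq_true S hS
  simp only [localSignsCheck, withNat_eq, Bool.and_eq_true, allMembers_eq, List.all_eq_true]
    at this
  obtain ⟨r, hr, q, hq, hB, hv, m1, m2, m3, m4⟩ := exists_mem_signTable d hd c hcd b hbc a hab
  have := (this.1.1 x hx).2 r hr q hq
  rw [checkQuadruple_eq, hB, land_quadruple S hS d hd c hcd b hbc a hab ha hb hc hd'] at this
  simp only [Nat.beq_refl, Bool.not_true, Bool.false_or, List.any_eq_true] at this
  obtain ⟨v, hvq, hvx⟩ := this
  have hvx : x &&& q.2.1 = v := Nat.eq_of_beq_eq_true hvx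
  have hv := hv v hvq
  simpa only [← hvx, Nat.testBit_and, m1, m2, m3, m4, Bool.and_true] using hv

/-- The listed vectors have no bits outside `tripleBits S`, so the triples inside `S` determine
them. -/
theorem eq_of_mem_localSigns {S x y : ℕ} (hS : S < 64) (hx : x ∈ localSigns S)
    (hy : y ∈ localSigns S) (h : ∀ a b c, a < b → b < c → c < 6 → S.testBit a = true →
      S.testBit b = true → S.testBit c = true →
      x.testBit (tripleIndex a b c) = y.testBit (tripleIndex a b c)) : x = y := by
  have := localSignsCheck_eq_true S hS
  simp only [localSignsCheck, withNat_eq, Bool.and_eq_true, allMembers_eq, List.all_eq_true]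
    at this
  have ex : x &&& tripleBits S = x := Nat.eq_of_beq_eq_true (this.1.1 x hx).1
  have ey : y &&& tripleBits S = y := Nat.eq_of_beq_eq_true (this.1.1 y hy).1
  rw [← ex, ← ey]
  refine Nat.eq_of_testBit_eq fun i => ?_
  rw [Nat.testBit_and, Nat.testBit_and]
  have hT := exists_of_testBit_tripleBits S hS
  cases hi : (tripleBits S).testBit i
  · simp
  · have hi20 : i < 20 := by
      by_contra hc
      rw [Nat.testBit_lt_two_pow (hT.1.trans_le (Nat.pow_le_pow_right (by norm_num)
        (not_lt.1 hc)))] at hi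
      exact absurd hi (by decide)
    obtain ⟨c, hc, b, hb, a, ha, s1, s2, s3, rfl⟩ := hT.2 i hi20 hi
    rw [h a b c ha hb hc s1 s2 s3]

theorem testBit_sum_range : ∀ x₀ x₁ x₂ x₃ x₄ x₅ : Bool,
    let s := x₀.toNat + 2 * x₁.toNat + 4 * x₂.toNat + 8 * x₃.toNat + 16 * x₄.toNat + 32 * x₅.toNat
    s < 64 ∧ s.testBit 0 = x₀ ∧ s.testBit 1 = x₁ ∧ s.testBit 2 = x₂ ∧ s.testBit 3 = x₃ ∧
      s.testBit 4 = x₄ ∧ s.testBit 5 = x₅ := by decide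

/-! ### The recursive inequality for the number of constructed arrangements. -/

instance (h b : ℕ) (P : ℤ × ℤ) : Decidable (OnBundle h b P) :=
  inferInstanceAs (Decidable (_ ∧ _))

/-- The bit set of the bundles with a line through `P / 3`. -/
def bundleSet (h : ℕ) (P : ℤ × ℤ) : ℕ :=
  (decide (OnBundle h 0 P)).toNat + 2 * (decide (OnBundle h 1 P)).toNat +
    4 * (decide (OnBundle h 2 P)).toNat + 8 * (decide (OnBundle h 3 P)).toNat +
    16 * (decide (OnBundle h 4 P)).toNat + 32 * (decide (OnBundle h 5 P)).toNat

theorem bundleSet_lt (h : ℕ) (P : ℤ × ℤ) : bundleSet h P < 64 :=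
  (testBit_sum_range _ _ _ _ _ _).1

theorem testBit_bundleSet {h b : ℕ} (hb : b < 6) (P : ℤ × ℤ) :
    (bundleSet h P).testBit b = true ↔ OnBundle h b P := by
  have := (testBit_sum_range (decide (OnBundle h 0 P)) (decide (OnBundle h 1 P))
    (decide (OnBundle h 2 P)) (decide (OnBundle h 3 P)) (decide (OnBundle h 4 P))
    (decide (OnBundle h 5 P))).2
  rw [← decide_eq_true_iff (p := OnBundle h b P), ← Bool.eq_iff_iff]
  unfold bundleSet
  interval_cases b
  exacts [this.1, this.2.1, this.2.2.1, this.2.2.2.1, this.2.2.2.2.1, this.2.2.2.2.2]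

theorem OnBundle.exists_through {h b : ℕ} {P : ℤ × ℤ} (hP : OnBundle h b P) :
    ∃ i, i < (b + 1) * (2 * h + 1) ∧ i / (2 * h + 1) = b ∧ Through h P i := by
  obtain ⟨⟨u, hu⟩, habs⟩ := hP
  have := abs_le.1 habs
  obtain ⟨t, ht⟩ : ∃ t : ℕ, (t : ℤ) = h - u := ⟨(h - u).toNat, by omega⟩
  have htl : t < 2 * h + 1 := by omega
  have h1 : (b * (2 * h + 1) + t) / (2 * h + 1) = b := by
    rw [mul_comm, Nat.mul_add_div (by omega), Nat.div_eq_of_lt htl, add_zero]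
  have h2 : (b * (2 * h + 1) + t) % (2 * h + 1) = t := by
    rw [mul_comm, Nat.mul_add_mod, Nat.mod_eq_of_lt htl]
  refine ⟨b * (2 * h + 1) + t, by rw [add_one_mul]; omega, h1, ?_⟩
  unfold Through
  rw [h1, h2]
  omega

/-- The isomorphism classes of the constructed arrangements. -/
def constructedClasses (n : ℕ) : Set (PseudolineArrangement.IsoClass n) :=
  PseudolineArrangement.isoClass '' {A : PseudolineArrangement n | IsConstructed A}

theorem isoClass_out {n : ℕ} (q : PseudolineArrangement.IsoClass n) :
    PseudolineArrangement.isoClass (Quotient.out q) = q := Quotient.out_eq q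

theorem isConstructed_out {n : ℕ} {q : PseudolineArrangement.IsoClass n}
    (hq : q ∈ constructedClasses n) : IsConstructed (Quotient.out q) := by
  obtain ⟨A, hA, rfl⟩ := hq
  exact IsConstructed.of_isomorphic hA
    (PseudolineArrangement.isoClass_eq_iff.1 (isoClass_out _)).symm

/-- The signs of a family of classes of arrangements. -/
noncomputable def familySigns {m : ℕ} (q : Fin 6 → PseudolineArrangement.IsoClass m) (b : ℕ) :
    ℕ → ℕ → ℕ → Bool :=
  if hb : b < 6 then (Quotient.out (q ⟨b, hb⟩)).orient else fun _ _ _ => false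

theorem junctionSigns_label {n h : ℕ} (hm : bundleSize n = 2 * h + 1) (pts : Finset (ℤ × ℤ))
    (ψ : ℤ × ℤ → ℕ) (q : Fin 6 → PseudolineArrangement.IsoClass (bundleSize n)) (b : Fin 6)
    (i j k : Fin (bundleSize n)) :
    junctionSigns h pts ψ (familySigns q) (label b i : Fin n) (label b j : Fin n)
      (label b k : Fin n) = (Quotient.out (q b)).orient i j k := by
  have val : ∀ t : Fin (bundleSize n), ((label b t : Fin n) : ℕ) = (2 * h + 1) * b + t := by
    intro t; rw [← hm, mul_comm]; rfl
  have tlt : ∀ t : Fin (bundleSize n), (t : ℕ) < 2 * h + 1 := fun t => hm ▸ t.2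
  have hdiv : ∀ t : Fin (bundleSize n), ((2 * h + 1) * b + t : ℕ) / (2 * h + 1) = b := by
    intro t
    rw [Nat.mul_add_div (by omega), Nat.div_eq_of_lt (tlt t), add_zero]
  have hmod : ∀ t : Fin (bundleSize n), ((2 * h + 1) * b + t : ℕ) % (2 * h + 1) = t := by
    intro t
    rw [Nat.mul_add_mod, Nat.mod_eq_of_lt (tlt t)]
  have hlt : (2 * h + 1) * (b : ℕ) + k < 6 * (2 * h + 1) := by
    have h1 : ((b : ℕ) + 1) * (2 * h + 1) ≤ 6 * (2 * h + 1) := Nat.mul_le_mul_right _ b.2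
    have := tlt k
    rw [add_one_mul, mul_comm] at h1
    omega
  unfold junctionSigns
  rw [val, val, val, if_neg (by omega), hdiv, hdiv, hmod, hmod, hmod, if_pos rfl]
  simp [familySigns]

/-- A local vector at each point and a constructed class in each bundle together give consistent
signs, hence a constructed arrangement, and both can be read off from its signs. -/
theorem prod_mul_numConstructed_le {n h : ℕ} (hn : 6 ≤ n) (hm : bundleSize n = 2 * h + 1)
    (pts : Finset (ℤ × ℤ)) :
    (∏ P ∈ pts, (localSigns (bundleSet h P)).length) * numConstructed (bundleSize n) ^ 6 ≤
      numConstructed n := by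
  classical
  let C := (constructedClasses (bundleSize n)).toFinite.toFinset
  let C' := (constructedClasses n).toFinite.toFinset
  have hC : numConstructed (bundleSize n) = C.card :=
    Set.ncard_eq_toFinset_card _ (constructedClasses (bundleSize n)).toFinite
  have hC' : numConstructed n = C'.card :=
    Set.ncard_eq_toFinset_card _ (constructedClasses n).toFinite
  let D := (pts.pi fun P => (localSigns (bundleSet h P)).toFinset) ×ˢ
    (Fintype.piFinset fun _ : Fin 6 => C)
  have hD : D.card = (∏ P ∈ pts, (localSigns (bundleSet h P)).length) * C.card ^ 6 := by
    rw [Finset.card_product, Finset.card_pi, Fintype.card_piFinset, Finset.prod_const,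
      Finset.card_univ, Fintype.card_fin]
    congr 1
    exact Finset.prod_congr rfl fun P _ =>
      List.toFinset_card_of_nodup (localSigns_nodup (bundleSet_lt h P))
  rw [hC, hC', ← hD]
  have h6 : 6 * (2 * h + 1) ≤ n := hm ▸ six_mul_bundleSize_le n
  let ext : (∀ P ∈ pts, ℕ) → ℤ × ℤ → ℕ := fun φ P => if hP : P ∈ pts then φ P hP else 0
  have hext : ∀ (φ : ∀ P ∈ pts, ℕ) (P) (hP : P ∈ pts), ext φ P = φ P hP := fun φ P hP => by
    simp only [ext, hP, dif_pos]
  -- A relation replaces an injection: every choice of data is related to a class, and no class is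
  -- related to two choices.
  refine Finset.card_le_card_of_forall_subsingleton
    (fun x c => ∃ A : PseudolineArrangement n, PseudolineArrangement.isoClass A = c ∧
      ∀ i j k : Fin n, i < j → j < k →
        A.orient i j k = junctionSigns h pts (ext x.1) (familySigns x.2) i j k) ?_ ?_
  · rintro ⟨φ, q⟩ hx
    simp only [D, Finset.mem_product, Finset.mem_pi, Fintype.mem_piFinset, List.mem_toFinset] at hx
    obtain ⟨hφ, hq⟩ := hx
    have hq : ∀ b, q b ∈ constructedClasses (bundleSize n) := fun b => by
      simpa [C] using hq b
    have hcons : ConsistentSigns n (junctionSigns h pts (ext φ) (familySigns q)) := by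
      refine consistentSigns_junctionSigns ?_ ?_
      · intro P hP a b c d hab hbc hcd hd ha hb hc hd'
        rw [hext φ P hP]
        refine monoSigns_of_mem_localSigns (bundleSet_lt h P) (hφ P hP) hab hbc hcd hd ?_ ?_ ?_ ?_
        · exact (testBit_bundleSet (by omega) P).2 ha
        · exact (testBit_bundleSet (by omega) P).2 hb
        · exact (testBit_bundleSet (by omega) P).2 hc
        · exact (testBit_bundleSet hd P).2 hd'
      · intro b hb
        unfold familySigns
        rw [dif_pos hb, ← hm]
        exact PseudolineArrangement.consistentSigns_orient _
    obtain ⟨A, hA⟩ := PseudolineArrangement.exists_orient_eq hcons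
    refine ⟨PseudolineArrangement.isoClass A, ?_, A, rfl, hA⟩
    rw [Set.Finite.mem_toFinset]
    refine ⟨A, IsConstructed.step hn A (isJunction_of_orient hm hA) fun b => ?_, rfl⟩
    refine (isConstructed_out (hq b)).of_isomorphic
      (PseudolineArrangement.isomorphic_of_orient fun i j k hij hjk => ?_)
    rw [PseudolineArrangement.restrict_orient, hA _ _ _ ((label b).lt_iff_lt.2 hij)
      ((label b).lt_iff_lt.2 hjk), junctionSigns_label hm]
  · rintro c - ⟨φ, q⟩ ⟨hx, A, rfl, hA⟩ ⟨φ', q'⟩ ⟨hx', A', hAA', hA'⟩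
    have hiso := PseudolineArrangement.isoClass_eq_iff.1 hAA'
    have heq : ∀ i j k : Fin n, i < j → j < k →
        junctionSigns h pts (ext φ) (familySigns q) i j k =
        junctionSigns h pts (ext φ') (familySigns q') i j k := by
      intro i j k hij hjk
      rw [← hA i j k hij hjk, ← hA' i j k hij hjk, hiso.orient_eq hij hjk]
    simp only [D, Finset.mem_product, Finset.mem_pi, List.mem_toFinset] at hx hx'
    refine Prod.ext ?_ ?_
    · funext P hP
      refine eq_of_mem_localSigns (bundleSet_lt h P) (hx.1 P hP) (hx'.1 P hP) ?_
      intro a b c hab hbc hc ha hb hc'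
      rw [testBit_bundleSet (by omega)] at ha hb hc'
      -- Actual lines through `P` in the three bundles; the sign of this triple is the bit of the
      -- local vector.
      obtain ⟨i, hi, rfl, ti⟩ := ha.exists_through
      obtain ⟨j, hj, rfl, tj⟩ := hb.exists_through
      obtain ⟨k, hk, rfl, tk⟩ := hc'.exists_through
      have hk6 : k < 6 * (2 * h + 1) := (Nat.div_lt_iff_lt_mul (by omega)).1 hc
      have hij : i < j := by
        by_contra hc
        exact absurd (Nat.div_le_div_right (c := 2 * h + 1) (not_lt.1 hc)) hab.not_ge
      have hjk : j < k := by
        by_contra hc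
        exact absurd (Nat.div_le_div_right (c := 2 * h + 1) (not_lt.1 hc)) hbc.not_ge
      have := heq ⟨i, by omega⟩ ⟨j, by omega⟩ ⟨k, by omega⟩ hij hjk
      rwa [junctionSigns_of_through hk6 hab hbc hP ti tj tk,
        junctionSigns_of_through hk6 hab hbc hP ti tj tk, hext _ _ hP, hext _ _ hP] at this
    · funext b
      change q b = q' b
      rw [← isoClass_out (q b), ← isoClass_out (q' b), PseudolineArrangement.isoClass_eq_iff]
      refine PseudolineArrangement.isomorphic_of_orient fun i j k hij hjk => ?_
      rw [← junctionSigns_label hm pts (ext φ) q, ← junctionSigns_label hm pts (ext φ') q']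
      exact heq _ _ _ ((label b).lt_iff_lt.2 hij) ((label b).lt_iff_lt.2 hjk)

/-! ### Counting the multiple crossings by type. -/

/-- A box of points which contains all multiple crossings. -/
noncomputable def crossingPoints (h : ℕ) : Finset (ℤ × ℤ) :=
  Finset.Icc (-6 * h : ℤ) (6 * h) ×ˢ Finset.Icc (-6 * h : ℤ) (6 * h)

/-- The number of points on exactly the bundles in the bit set `S`. -/
noncomputable def pointCount (h S : ℕ) : ℕ := ((crossingPoints h).filter fun P => bundleSet h P = S).card

theorem onBundle_neg {h b : ℕ} {P : ℤ × ℤ} : OnBundle h b (-P) ↔ OnBundle h b P := by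
  have : normalForm b (-P) = - normalForm b P := by
    simp only [normalForm, Prod.fst_neg, Prod.snd_neg]; ring
  simp only [OnBundle, this, dvd_neg, abs_neg]

theorem bundleSet_neg {h : ℕ} {P : ℤ × ℤ} : bundleSet h (-P) = bundleSet h P := by
  simp only [bundleSet, onBundle_neg]

/-- The picture is symmetric about the origin, so points in the open half-plane `c * x + d * y > 0`
count twice. They are listed in `N` rows of `len i` points. -/
theorem two_mul_sum_le_pointCount {h S N : ℕ} {len : ℕ → ℕ} {f : ℕ → ℕ → ℤ × ℤ} (c d : ℤ)
    (hS : ∀ i < N, ∀ j < len i, bundleSet h (f i j) = S)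
    (hpos : ∀ i < N, ∀ j < len i, 0 < c * (f i j).1 + d * (f i j).2)
    (hbox : ∀ i < N, ∀ j < len i, (-6 * h ≤ (f i j).1 ∧ (f i j).1 ≤ 6 * h) ∧
      (-6 * h ≤ (f i j).2 ∧ (f i j).2 ≤ 6 * h))
    (hinj : ∀ i < N, ∀ j < len i, ∀ i' < N, ∀ j' < len i', (f i j).1 = (f i' j').1 →
      (f i j).2 = (f i' j').2 → i = i' ∧ j = j') :
    2 * ∑ i ∈ Finset.range N, len i ≤ pointCount h S := by
  classical
  have hcard : (((Finset.range N).sigma fun i => Finset.range (len i)) ×ˢ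
      (Finset.univ : Finset Bool)).card = 2 * ∑ i ∈ Finset.range N, len i := by
    rw [Finset.card_product, Finset.card_sigma, Finset.card_univ, Fintype.card_bool, mul_comm]
    simp
  rw [← hcard]
  refine Finset.card_le_card_of_injOn
    (fun x => if x.2 then f x.1.1 x.1.2 else - f x.1.1 x.1.2) ?_ ?_
  · rintro ⟨⟨i, j⟩, e⟩ hx
    simp only [Finset.coe_product, Finset.coe_univ, Set.mem_prod, Finset.mem_coe, Finset.mem_sigma,
      Finset.mem_range, Set.mem_univ, and_true] at hx
    have h1 := hbox i hx.1 j hx.2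
    have h2 := hS i hx.1 j hx.2
    simp only [Finset.mem_coe, Finset.mem_filter, crossingPoints, Finset.mem_product,
      Finset.mem_Icc]
    cases e
    · simp only [Bool.false_eq_true, if_false, bundleSet_neg, Prod.fst_neg, Prod.snd_neg]
      exact ⟨⟨⟨by omega, by omega⟩, by omega, by omega⟩, h2⟩
    · simp only [if_true]
      exact ⟨h1, h2⟩
  · rintro ⟨⟨i, j⟩, e⟩ hx ⟨⟨i', j'⟩, e'⟩ hx' heq
    simp only [Finset.coe_product, Finset.coe_univ, Set.mem_prod, Finset.mem_coe, Finset.mem_sigma,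
      Finset.mem_range, Set.mem_univ, and_true] at hx hx'
    have p1 := hpos i hx.1 j hx.2
    have p2 := hpos i' hx'.1 j' hx'.2
    have e1 := congrArg Prod.fst heq
    have e2 := congrArg Prod.snd heq
    have inj := hinj i hx.1 j hx.2 i' hx'.1 j' hx'.2
    cases e <;> cases e' <;> simp only [Bool.false_eq_true, if_false, if_true, Prod.fst_neg,
      Prod.snd_neg] at e1 e2
    · obtain ⟨rfl, rfl⟩ := inj (neg_injective e1) (neg_injective e2)
      rfl
    · rw [← e1, ← e2] at p2
      linarith
    · rw [e1, e2] at p1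
      linarith
    · obtain ⟨rfl, rfl⟩ := inj e1 e2
      rfl

theorem bundleSet_eq {h : ℕ} {P : ℤ × ℤ} {x₀ x₁ x₂ x₃ x₄ x₅ : Bool}
    (h₀ : OnBundle h 0 P ↔ x₀ = true) (h₁ : OnBundle h 1 P ↔ x₁ = true)
    (h₂ : OnBundle h 2 P ↔ x₂ = true) (h₃ : OnBundle h 3 P ↔ x₃ = true)
    (h₄ : OnBundle h 4 P ↔ x₄ = true) (h₅ : OnBundle h 5 P ↔ x₅ = true) :
    bundleSet h P = x₀.toNat + 2 * x₁.toNat + 4 * x₂.toNat + 8 * x₃.toNat + 16 * x₄.toNat +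
      32 * x₅.toNat := by
  simp only [bundleSet, h₀, h₁, h₂, h₃, h₄, h₅, Bool.decide_eq_true]

theorem onBundle_lattice (h : ℕ) (s r : ℤ) :
    (OnBundle h 0 (3 * s, 3 * r) ↔ -h ≤ s ∧ s ≤ h) ∧
    (OnBundle h 1 (3 * s, 3 * r) ↔ -h ≤ 2 * s + r ∧ 2 * s + r ≤ h) ∧
    (OnBundle h 2 (3 * s, 3 * r) ↔ -h ≤ s + r ∧ s + r ≤ h) ∧
    (OnBundle h 3 (3 * s, 3 * r) ↔ -h ≤ s + 2 * r ∧ s + 2 * r ≤ h) ∧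
    (OnBundle h 4 (3 * s, 3 * r) ↔ -h ≤ r ∧ r ≤ h) ∧
    (OnBundle h 5 (3 * s, 3 * r) ↔ -h ≤ r - s ∧ r - s ≤ h) := by
  simp only [OnBundle, normalForm, normalA, normalB, abs_le]
  omega

theorem bundleSet_lattice {h : ℕ} {s r : ℤ} (x₀ x₁ x₂ x₃ x₄ x₅ : Bool)
    (h₀ : (-h ≤ s ∧ s ≤ h) ↔ x₀ = true) (h₁ : (-h ≤ 2 * s + r ∧ 2 * s + r ≤ h) ↔ x₁ = true)
    (h₂ : (-h ≤ s + r ∧ s + r ≤ h) ↔ x₂ = true)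
    (h₃ : (-h ≤ s + 2 * r ∧ s + 2 * r ≤ h) ↔ x₃ = true)
    (h₄ : (-h ≤ r ∧ r ≤ h) ↔ x₄ = true) (h₅ : (-h ≤ r - s ∧ r - s ≤ h) ↔ x₅ = true) :
    bundleSet h (3 * s, 3 * r) = x₀.toNat + 2 * x₁.toNat + 4 * x₂.toNat + 8 * x₃.toNat +
      16 * x₄.toNat + 32 * x₅.toNat := by
  obtain ⟨e₀, e₁, e₂, e₃, e₄, e₅⟩ := onBundle_lattice h s r
  exact bundleSet_eq (e₀.trans h₀) (e₁.trans h₁) (e₂.trans h₂) (e₃.trans h₃) (e₄.trans h₄)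
    (e₅.trans h₅)

theorem le_pointCount_all (h : ℕ) :
    2 * ∑ i ∈ Finset.range h, (2 * h - (i + 1)) / 3 ≤ pointCount h 63 := by
  -- Row `r - s = d` with `d = i + 1`: the strips of bundles 1 and 3 require `-h ≤ 3s + d` and `3s +
  -- 2d ≤ h`, so `s` starts at `-⌊(h + d)/3⌋`.
  refine two_mul_sum_le_pointCount (f := fun i j =>
    (3 * (-((h + (i + 1)) / 3 : ℕ) + j : ℤ), 3 * (-((h + (i + 1)) / 3 : ℕ) + j + (i + 1) : ℤ)))
    (-1) 1 ?_ ?_ ?_ ?_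
  · intro i hi j hj
    refine bundleSet_lattice true true true true true true ?_ ?_ ?_ ?_ ?_ ?_ <;>
      simp only [iff_true] <;> omega
  all_goals intro i hi j hj
  all_goals simp only
  · omega
  · omega
  · omega

theorem le_pointCount_five (h : ℕ) :
    2 * ∑ i ∈ Finset.range h, (h - 1 - i) / 3 ≤ pointCount h 61 ∧
    2 * ∑ i ∈ Finset.range h, (h - 1 - i) / 3 ≤ pointCount h 55 ∧
    2 * ∑ i ∈ Finset.range h, (h - 1 - i) / 3 ≤ pointCount h 31 := by
  refine ⟨?_, ?_, ?_⟩
  -- Rows `2s + r = h + 1 + i`, just outside the strip of the missing bundle 1; `s + 2r ≤ h` fixes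
  -- the first `s`. The other two cases leave the strips of bundles 3 and 5 likewise.
  · refine two_mul_sum_le_pointCount (f := fun i j =>
      (3 * (((h + 4 + 2 * i) / 3 : ℕ) + j : ℤ),
        3 * (h + 1 + i - 2 * (((h + 4 + 2 * i) / 3 : ℕ) + j) : ℤ))) 2 1 ?_ ?_ ?_ ?_
    · intro i hi j hj
      refine bundleSet_lattice true false true true true true ?_ ?_ ?_ ?_ ?_ ?_ <;>
        simp only [iff_true, Bool.false_eq_true, iff_false] <;> omega
    all_goals intro i hi j hj
    all_goals simp only
    all_goals omega
  · refine two_mul_sum_le_pointCount (f := fun i j =>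
      (3 * (h + 1 + i - 2 * (((h + 4 + 2 * i) / 3 : ℕ) + j) : ℤ),
        3 * (((h + 4 + 2 * i) / 3 : ℕ) + j : ℤ))) 1 2 ?_ ?_ ?_ ?_
    · intro i hi j hj
      refine bundleSet_lattice true true true false true true ?_ ?_ ?_ ?_ ?_ ?_ <;>
        simp only [iff_true, Bool.false_eq_true, iff_false] <;> omega
    all_goals intro i hi j hj
    all_goals simp only
    all_goals omega
  · refine two_mul_sum_le_pointCount (f := fun i j =>
      (3 * (-((2 * h + 1 + i) / 3 : ℕ) + j : ℤ),
        3 * (-((2 * h + 1 + i) / 3 : ℕ) + j + (h + 1 + i) : ℤ))) (-1) 1 ?_ ?_ ?_ ?_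
    · intro i hi j hj
      refine bundleSet_lattice true true true true true false ?_ ?_ ?_ ?_ ?_ ?_ <;>
        simp only [iff_true, Bool.false_eq_true, iff_false] <;> omega
    all_goals intro i hi j hj
    all_goals simp only
    all_goals omega

theorem le_pointCount_four (h : ℕ) :
    2 * ∑ i ∈ Finset.range (h / 3), (h - 3 * i - 1) ≤ pointCount h 23 ∧
    2 * ∑ i ∈ Finset.range (h / 3), (h - 3 * i - 1) ≤ pointCount h 29 ∧
    2 * ∑ i ∈ Finset.range (h / 3), (h - 3 * i - 1) ≤ pointCount h 53 := by
  refine ⟨?_, ?_, ?_⟩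
  · refine two_mul_sum_le_pointCount (f := fun i j =>
      (3 * (-h + 2 * i + 1 + j : ℤ), 3 * (h - i : ℤ))) 0 1 ?_ ?_ ?_ ?_
    · intro i hi j hj
      refine bundleSet_lattice true true true false true false ?_ ?_ ?_ ?_ ?_ ?_ <;>
        simp only [iff_true, Bool.false_eq_true, iff_false] <;> omega
    all_goals intro i hi j hj
    all_goals simp only
    all_goals omega
  · refine two_mul_sum_le_pointCount (f := fun i j =>
      (3 * (h - i : ℤ), 3 * (-h + 2 * i + 1 + j : ℤ))) 1 0 ?_ ?_ ?_ ?_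
    · intro i hi j hj
      refine bundleSet_lattice true false true true true false ?_ ?_ ?_ ?_ ?_ ?_ <;>
        simp only [iff_true, Bool.false_eq_true, iff_false] <;> omega
    all_goals intro i hi j hj
    all_goals simp only
    all_goals omega
  · refine two_mul_sum_le_pointCount (f := fun i j =>
      (3 * (i + 1 + j : ℤ), 3 * (h - i - (i + 1 + j) : ℤ))) 1 1 ?_ ?_ ?_ ?_
    · intro i hi j hj
      refine bundleSet_lattice true false true false true true ?_ ?_ ?_ ?_ ?_ ?_ <;>
        simp only [iff_true, Bool.false_eq_true, iff_false] <;> omega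
    all_goals intro i hi j hj
    all_goals simp only
    all_goals omega

theorem le_pointCount_three (h : ℕ) :
    2 * ∑ i ∈ Finset.range h, (h - i) ≤ pointCount h 49 ∧
    2 * ∑ i ∈ Finset.range h, (h - i) ≤ pointCount h 7 ∧
    2 * ∑ i ∈ Finset.range h, (h - i) ≤ pointCount h 28 := by
  refine ⟨?_, ?_, ?_⟩
  · refine two_mul_sum_le_pointCount (f := fun i j =>
      (3 * (h - i : ℤ), 3 * (i + 1 + j : ℤ))) 1 1 ?_ ?_ ?_ ?_
    · intro i hi j hj
      refine bundleSet_lattice true false false false true true ?_ ?_ ?_ ?_ ?_ ?_ <;>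
        simp only [iff_true, Bool.false_eq_true, iff_false] <;> omega
    all_goals intro i hi j hj
    all_goals simp only
    all_goals omega
  · refine two_mul_sum_le_pointCount (f := fun i j =>
      (3 * (-h + j : ℤ), 3 * (h + 1 + i : ℤ))) 0 1 ?_ ?_ ?_ ?_
    · intro i hi j hj
      refine bundleSet_lattice true true true false false false ?_ ?_ ?_ ?_ ?_ ?_ <;>
        simp only [iff_true, Bool.false_eq_true, iff_false] <;> omega
    all_goals intro i hi j hj
    all_goals simp only
    all_goals omega
  · refine two_mul_sum_le_pointCount (f := fun i j =>
      (3 * (h + 1 + i : ℤ), 3 * (-h + j : ℤ))) 1 0 ?_ ?_ ?_ ?_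
    · intro i hi j hj
      refine bundleSet_lattice false false true true true false ?_ ?_ ?_ ?_ ?_ ?_ <;>
        simp only [iff_true, Bool.false_eq_true, iff_false] <;> omega
    all_goals intro i hi j hj
    all_goals simp only
    all_goals omega

theorem onBundle_diagonal (h : ℕ) (u v : ℤ) :
    (OnBundle h 0 (2 * u - v, 2 * v - u) ↔ 3 ∣ u + v ∧ -(3 * h) ≤ 2 * u - v ∧ 2 * u - v ≤ 3 * h) ∧
    (OnBundle h 1 (2 * u - v, 2 * v - u) ↔ -h ≤ u ∧ u ≤ h) ∧
    (OnBundle h 2 (2 * u - v, 2 * v - u) ↔ 3 ∣ u + v ∧ -(3 * h) ≤ u + v ∧ u + v ≤ 3 * h) ∧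
    (OnBundle h 3 (2 * u - v, 2 * v - u) ↔ -h ≤ v ∧ v ≤ h) ∧
    (OnBundle h 4 (2 * u - v, 2 * v - u) ↔ 3 ∣ u + v ∧ -(3 * h) ≤ 2 * v - u ∧ 2 * v - u ≤ 3 * h) ∧
    (OnBundle h 5 (2 * u - v, 2 * v - u) ↔ -h ≤ v - u ∧ v - u ≤ h) := by
  simp only [OnBundle, normalForm, normalA, normalB, abs_le]
  omega

/-- Bundles 1, 3 and 5 also meet at points with denominator 3, which miss the other bundles when `3
∤ u + v`. In the row `v - u = d` this means `u ≢ d` modulo 3, so `u` runs through the two other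
residues, two values per block of three. -/
theorem le_pointCount_diagonal (h : ℕ) :
    2 * ∑ i ∈ Finset.range h, 2 * ((2 * h - (i + 1)) / 3) ≤ pointCount h 42 := by
  refine two_mul_sum_le_pointCount (f := fun i j =>
    let u : ℤ := i + 1 - 3 * ((i + 1 + h + 1) / 3 : ℕ) + 3 * (j / 2 : ℕ) + 1 + (j % 2 : ℕ)
    (2 * u - (u + (i + 1)), 2 * (u + (i + 1)) - u)) (-1) 1 ?_ ?_ ?_ ?_
  · intro i hi j hj
    obtain ⟨e₀, e₁, e₂, e₃, e₄, e₅⟩ := onBundle_diagonal h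
      (i + 1 - 3 * ((i + 1 + h + 1) / 3 : ℕ) + 3 * (j / 2 : ℕ) + 1 + (j % 2 : ℕ))
      (i + 1 - 3 * ((i + 1 + h + 1) / 3 : ℕ) + 3 * (j / 2 : ℕ) + 1 + (j % 2 : ℕ) + (i + 1))
    refine bundleSet_eq (x₀ := false) (x₁ := true) (x₂ := false) (x₃ := true) (x₄ := false)
      (x₅ := true) (e₀.trans ?_) (e₁.trans ?_) (e₂.trans ?_) (e₃.trans ?_) (e₄.trans ?_)
      (e₅.trans ?_) <;>
      simp only [iff_true, Bool.false_eq_true, iff_false] <;> omega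
  all_goals intro i hi j hj
  all_goals simp only
  all_goals omega

/-! ### Asymptotics of the counts and solution of the recursion. -/

theorem sum_range_id_real (n : ℕ) : ∑ i ∈ Finset.range n, (i : ℝ) = n * (n - 1) / 2 := by
  induction n with
  | zero => simp
  | succ n ih => rw [Finset.sum_range_succ, ih]; push_cast; ring

/-- A linear lower bound of the terms of a sum bounds the sum. -/
theorem le_sum_of_linear {N : ℕ} {len : ℕ → ℕ} (a b : ℝ)
    (hlen : ∀ i < N, a - b * i ≤ (len i : ℝ)) :
    N * a - b * (N * (N - 1) / 2) ≤ ((∑ i ∈ Finset.range N, len i : ℕ) : ℝ) := by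
  rw [Nat.cast_sum]
  calc N * a - b * (N * (N - 1) / 2) = ∑ i ∈ Finset.range N, (a - b * (i : ℝ)) := by
        rw [Finset.sum_sub_distrib, ← Finset.mul_sum, sum_range_id_real]; simp
    _ ≤ _ := Finset.sum_le_sum fun i hi => hlen i (Finset.mem_range.1 hi)

theorem le_cast_div_three (a : ℕ) : ((a : ℝ) - 2) / 3 ≤ ((a / 3 : ℕ) : ℝ) := by
  have : a ≤ 3 * (a / 3) + 2 := by omega
  have : (a : ℝ) ≤ 3 * ((a / 3 : ℕ) : ℝ) + 2 := by exact_mod_cast this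
  linarith

theorem pointCount_all_ge (h : ℕ) : (h : ℝ) ^ 2 - 5 / 3 * h ≤ pointCount h 63 := by
  have h1 : ((2 * ∑ i ∈ Finset.range h, (2 * h - (i + 1)) / 3 : ℕ) : ℝ) ≤ pointCount h 63 := by
    exact_mod_cast le_pointCount_all h
  have h2 := le_sum_of_linear (N := h) (len := fun i => (2 * h - (i + 1)) / 3)
    ((2 * h - 3) / 3) (1 / 3) (fun i hi => by
      have := le_cast_div_three (2 * h - (i + 1))
      rw [Nat.cast_sub (by omega)] at this
      push_cast at this
      linarith)
  push_cast at h1 h2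
  nlinarith

theorem pointCount_diagonal_ge (h : ℕ) :
    2 * (h : ℝ) ^ 2 - 10 / 3 * h ≤ pointCount h 42 := by
  have h1 : ((2 * ∑ i ∈ Finset.range h, 2 * ((2 * h - (i + 1)) / 3) : ℕ) : ℝ) ≤
      pointCount h 42 := by
    exact_mod_cast le_pointCount_diagonal h
  have h2 := le_sum_of_linear (N := h) (len := fun i => 2 * ((2 * h - (i + 1)) / 3))
    (2 * ((2 * h - 3) / 3)) (2 / 3) (fun i hi => by
      have := le_cast_div_three (2 * h - (i + 1))
      rw [Nat.cast_sub (by omega)] at this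
      push_cast at this ⊢
      linarith)
  push_cast at h1 h2
  nlinarith

theorem pointCount_five_ge (h : ℕ) :
    (h : ℝ) ^ 2 / 3 - 5 / 3 * h ≤ pointCount h 61 ∧
    (h : ℝ) ^ 2 / 3 - 5 / 3 * h ≤ pointCount h 55 ∧
    (h : ℝ) ^ 2 / 3 - 5 / 3 * h ≤ pointCount h 31 := by
  have h2 := le_sum_of_linear (N := h) (len := fun i => (h - 1 - i) / 3)
    ((h - 3) / 3) (1 / 3) (fun i hi => by
      have := le_cast_div_three (h - 1 - i)
      rw [Nat.cast_sub (by omega), Nat.cast_sub (by omega)] at this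
      push_cast at this
      linarith)
  have key : (h : ℝ) ^ 2 / 3 - 5 / 3 * h ≤
      ((2 * ∑ i ∈ Finset.range h, (h - 1 - i) / 3 : ℕ) : ℝ) := by
    push_cast at h2 ⊢
    nlinarith
  obtain ⟨a, b, c⟩ := le_pointCount_five h
  exact ⟨key.trans (by exact_mod_cast a), key.trans (by exact_mod_cast b),
    key.trans (by exact_mod_cast c)⟩

theorem pointCount_four_ge (h : ℕ) :
    (h : ℝ) ^ 2 / 3 - 2 / 3 * h ≤ pointCount h 23 ∧
    (h : ℝ) ^ 2 / 3 - 2 / 3 * h ≤ pointCount h 29 ∧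
    (h : ℝ) ^ 2 / 3 - 2 / 3 * h ≤ pointCount h 53 := by
  have h2 := le_sum_of_linear (N := h / 3) (len := fun i => h - 3 * i - 1)
    (h - 1) 3 (fun i hi => by
      have : h ≤ (h - 3 * i - 1) + 3 * i + 1 := by omega
      have : (h : ℝ) ≤ ((h - 3 * i - 1 : ℕ) : ℝ) + 3 * i + 1 := by exact_mod_cast this
      linarith)
  have key : (h : ℝ) ^ 2 / 3 - 2 / 3 * h ≤
      ((2 * ∑ i ∈ Finset.range (h / 3), (h - 3 * i - 1) : ℕ) : ℝ) := by
    have h3 := le_cast_div_three h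
    have h4 : 3 * ((h / 3 : ℕ) : ℝ) ≤ h := by exact_mod_cast Nat.mul_div_le h 3
    rw [Nat.cast_mul]
    have hN : (0 : ℝ) ≤ ((h / 3 : ℕ) : ℝ) := Nat.cast_nonneg _
    generalize ((∑ i ∈ Finset.range (h / 3), (h - 3 * i - 1) : ℕ) : ℝ) = X at *
    generalize ((h / 3 : ℕ) : ℝ) = N at *
    have h0 : (0 : ℝ) ≤ h := Nat.cast_nonneg h
    push_cast
    nlinarith [mul_nonneg hN (sub_nonneg.2 h4), mul_nonneg h0 (sub_nonneg.2 h3)]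
  obtain ⟨a, b, c⟩ := le_pointCount_four h
  exact ⟨key.trans (by exact_mod_cast a), key.trans (by exact_mod_cast b),
    key.trans (by exact_mod_cast c)⟩

theorem pointCount_three_ge (h : ℕ) :
    (h : ℝ) ^ 2 ≤ pointCount h 49 ∧ (h : ℝ) ^ 2 ≤ pointCount h 7 ∧
    (h : ℝ) ^ 2 ≤ pointCount h 28 := by
  have h2 := le_sum_of_linear (N := h) (len := fun i => h - i) h 1 (fun i hi => by
      rw [Nat.cast_sub hi.le]; linarith)
  have key : (h : ℝ) ^ 2 ≤ ((2 * ∑ i ∈ Finset.range h, (h - i) : ℕ) : ℝ) := by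
    have h0 : (0 : ℝ) ≤ h := Nat.cast_nonneg h
    rw [Nat.cast_mul]
    push_cast at h2 ⊢
    nlinarith
  obtain ⟨a, b, c⟩ := le_pointCount_three h
  exact ⟨key.trans (by exact_mod_cast a), key.trans (by exact_mod_cast b),
    key.trans (by exact_mod_cast c)⟩

theorem length_localSigns_pos {S : ℕ} (hS : S < 64) : 0 < (localSigns S).length :=
  List.length_pos_iff.2 (localSigns_ne_nil hS)

theorem logb_two_eight : Real.logb 2 8 = 3 := by
  rw [show (8 : ℝ) = 2 ^ (3 : ℝ) by norm_num, Real.logb_rpow (by norm_num) (by norm_num)]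

theorem c_mul : 120 * c = 8 + Real.logb 2 62 + Real.logb 2 908 := by
  have h : Real.logb 2 256 = 8 := by
    rw [show (256 : ℝ) = 2 ^ (8 : ℝ) by norm_num, Real.logb_rpow (by norm_num) (by norm_num)]
  unfold c
  rw [Real.logb_mul (by norm_num) (by norm_num), Real.logb_mul (by norm_num) (by norm_num), h]
  ring

/-- Only eleven bundle sets are used; the others contribute nonnegative terms. With `log₂ 62 ≤ 6`
and `log₂ 908 ≤ 10` the linear errors add up to at most `56 * h`. -/
theorem logb_prod_ge (h : ℕ) :
    120 * c * h ^ 2 - 60 * h ≤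
      Real.logb 2 ((∏ P ∈ crossingPoints h, (localSigns (bundleSet h P)).length : ℕ) : ℝ) := by
  have e1 : Real.logb 2 ((∏ P ∈ crossingPoints h, (localSigns (bundleSet h P)).length : ℕ) : ℝ) =
      ∑ S ∈ Finset.range 64, pointCount h S * Real.logb 2 (localSigns S).length := by
    rw [Nat.cast_prod, Real.logb_prod _ _ fun P _ =>
      Nat.cast_ne_zero.2 (length_localSigns_pos (bundleSet_lt h P)).ne']
    rw [← Finset.sum_fiberwise_of_maps_to (g := bundleSet h) (t := Finset.range 64)
      fun P _ => Finset.mem_range.2 (bundleSet_lt h P)]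
    refine Finset.sum_congr rfl fun S _ => ?_
    rw [pointCount, ← nsmul_eq_mul, ← Finset.sum_const]
    refine Finset.sum_congr rfl fun P hP => ?_
    rw [(Finset.mem_filter.1 hP).2]
  have e2 : ∑ S ∈ ({63, 61, 55, 31, 23, 29, 53, 42, 49, 7, 28} : Finset ℕ),
      pointCount h S * Real.logb 2 (localSigns S).length ≤
      ∑ S ∈ Finset.range 64, pointCount h S * Real.logb 2 (localSigns S).length := by
    refine Finset.sum_le_sum_of_subset_of_nonneg (by decide) fun S hS _ => ?_
    refine mul_nonneg (Nat.cast_nonneg _) (Real.logb_nonneg (by norm_num) ?_)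
    exact_mod_cast length_localSigns_pos (Finset.mem_range.1 hS)
  rw [e1]
  refine le_trans ?_ e2
  have l2 : Real.logb 2 2 = 1 := Real.logb_self_eq_one (by norm_num)
  rw [Finset.sum_insert (by decide), Finset.sum_insert (by decide), Finset.sum_insert (by decide),
    Finset.sum_insert (by decide), Finset.sum_insert (by decide), Finset.sum_insert (by decide),
    Finset.sum_insert (by decide), Finset.sum_insert (by decide), Finset.sum_insert (by decide),
    Finset.sum_insert (by decide), Finset.sum_singleton, length_localSigns_all,
    length_localSigns_five.1, length_localSigns_five.2.1, length_localSigns_five.2.2,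
    length_localSigns_four.1, length_localSigns_four.2.1, length_localSigns_four.2.2,
    length_localSigns_three.1, length_localSigns_three.2.1, length_localSigns_three.2.2.1,
    length_localSigns_three.2.2.2, c_mul]
  push_cast
  rw [l2, logb_two_eight]
  have b62 : Real.logb 2 62 ≤ 6 := by
    rw [Real.logb_le_iff_le_rpow (by norm_num) (by norm_num)]; norm_num
  have b908 : Real.logb 2 908 ≤ 10 := by
    rw [Real.logb_le_iff_le_rpow (by norm_num) (by norm_num)]; norm_num
  have p62 : 0 ≤ Real.logb 2 62 := Real.logb_nonneg (by norm_num) (by norm_num)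
  have p908 : 0 ≤ Real.logb 2 908 := Real.logb_nonneg (by norm_num) (by norm_num)
  have h0 : (0 : ℝ) ≤ h := Nat.cast_nonneg h
  obtain ⟨f1, f2, f3⟩ := pointCount_five_ge h
  obtain ⟨g1, g2, g3⟩ := pointCount_four_ge h
  obtain ⟨k1, k2, k3⟩ := pointCount_three_ge h
  have a1 := mul_le_mul_of_nonneg_right (pointCount_all_ge h) p908
  have a2 := mul_le_mul_of_nonneg_right f1 p62
  have a3 := mul_le_mul_of_nonneg_right f2 p62
  have a4 := mul_le_mul_of_nonneg_right f3 p62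
  have a5 := pointCount_diagonal_ge h
  have a6 := mul_le_mul_of_nonneg_left b62 h0
  have a7 := mul_le_mul_of_nonneg_left b908 h0
  linarith

/-- At most 5 pseudolines are lost by rounding and 6 more by making `m` odd. -/
theorem exists_bundleSize_eq {n : ℕ} (hn : 6 ≤ n) :
    ∃ h, bundleSize n = 2 * h + 1 ∧ n ≤ 6 * bundleSize n + 11 := by
  unfold bundleSize
  split_ifs with ho
  · obtain ⟨h, hh⟩ := ho
    exact ⟨h, hh, by omega⟩
  · rw [Nat.not_odd_iff_even] at ho
    obtain ⟨k, hk⟩ := ho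
    exact ⟨k - 1, by omega, by omega⟩

theorem numConstructed_pos (n : ℕ) : 0 < numConstructed n := by
  induction n using Nat.strong_induction_on with
  | _ n ih =>
    rcases lt_or_ge n 6 with hn | hn
    · obtain ⟨A, _⟩ := PseudolineArrangement.exists_orient_eq (n := n) (χ := fun _ _ _ => true)
        (fun i j k l _ _ _ _ => by simp [MonoSigns])
      exact (Set.ncard_pos (Set.toFinite _)).2 ⟨_, A, .base hn A, rfl⟩
    · obtain ⟨h, hm, _⟩ := exists_bundleSize_eq hn
      have hlt : bundleSize n < n := by
        have := six_mul_bundleSize_le n; omega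
      exact lt_of_lt_of_le (Nat.mul_pos (Finset.prod_pos fun P _ =>
        length_localSigns_pos (bundleSet_lt h P)) (pow_pos (ih _ hlt) 6))
        (prod_mul_numConstructed_le hn hm (crossingPoints h))

theorem c_le : c ≤ 0.2 := by
  have : Real.logb 2 (256 * 62 * 908) ≤ 24 := by
    rw [Real.logb_le_iff_le_rpow (by norm_num) (by norm_num)]; norm_num
  unfold c
  norm_num at this ⊢
  linarith

theorem lt_c : 0.1981 < c := by
  -- `5943 / 250 = 120 * 0.1981`; the 250th power turns the claim into one about integers.
  have : (5943 : ℝ) / 250 < Real.logb 2 (256 * 62 * 908) := by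
    rw [Real.lt_logb_iff_rpow_lt (by norm_num) (by norm_num)]
    have h1 : ((2 : ℝ) ^ ((5943 : ℝ) / 250)) ^ 250 = 2 ^ 5943 := by
      rw [← Real.rpow_natCast, ← Real.rpow_mul (by norm_num), ← Real.rpow_natCast]
      norm_num
    refine lt_of_pow_lt_pow_left₀ 250 (by norm_num) ?_
    rw [h1]
    have : (2 : ℕ) ^ 5943 < (256 * 62 * 908) ^ 250 := by decide +kernel
    exact_mod_cast this
  unfold c
  norm_num at this ⊢
  linarith

theorem logb_numConstructed_step {n : ℕ} (hn : 6 ≤ n) {h : ℕ} (hm : bundleSize n = 2 * h + 1) :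
    120 * c * h ^ 2 - 60 * h + 6 * Real.logb 2 (numConstructed (bundleSize n)) ≤
      Real.logb 2 (numConstructed n) := by
  have hT : (0 : ℝ) < numConstructed (bundleSize n) := by
    exact_mod_cast numConstructed_pos _
  have hP : (0 : ℝ) < ((∏ P ∈ crossingPoints h, (localSigns (bundleSet h P)).length : ℕ) : ℝ) := by
    exact_mod_cast Finset.prod_pos fun P _ => length_localSigns_pos (bundleSet_lt h P)
  have h1 : ((∏ P ∈ crossingPoints h, (localSigns (bundleSet h P)).length : ℕ) : ℝ) *
      (numConstructed (bundleSize n) : ℝ) ^ 6 ≤ numConstructed n := by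
    exact_mod_cast prod_mul_numConstructed_le hn hm (crossingPoints h)
  have h2 := Real.logb_le_logb_of_le (b := 2) (by norm_num) (by positivity) h1
  rw [Real.logb_mul hP.ne' (by positivity), Real.logb_pow] at h2
  have := logb_prod_ge h
  push_cast at h2 this
  linarith

/-- The factor 2 in the logarithm makes it at least 1, so that the term also absorbs `c * n ^ 2` for
`n < 6`. -/
theorem logb_numConstructed_ge (n : ℕ) (hn : 1 ≤ n) :
    c * n ^ 2 - 8 * (n * Real.logb 2 (2 * n)) ≤ Real.logb 2 (numConstructed n) := by
  have hc := c_le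
  have hc' : 0 < c := lt_trans (by norm_num) lt_c
  induction n using Nat.strong_induction_on with
  | _ n ih =>
    have hn1 : (1 : ℝ) ≤ n := by exact_mod_cast hn
    have hl1 : 1 ≤ Real.logb 2 (2 * n) := by
      rw [Real.logb_mul (by norm_num) (by linarith), Real.logb_self_eq_one (by norm_num)]
      linarith [Real.logb_nonneg (b := 2) (by norm_num) hn1]
    rcases lt_or_ge n 6 with h6 | h6
    · have h0 : 0 ≤ Real.logb 2 (numConstructed n) := Real.logb_nonneg (by norm_num) (by
        exact_mod_cast numConstructed_pos n)
      have h5 : (n : ℝ) ≤ 5 := by exact_mod_cast Nat.le_of_lt_succ h6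
      have h1 : c * n ^ 2 ≤ 0.2 * (n * 5) := by
        rw [pow_two]
        exact mul_le_mul hc (by nlinarith) (by positivity) (by norm_num)
      nlinarith
    · obtain ⟨h, hm, hle⟩ := exists_bundleSize_eq h6
      have hge := six_mul_bundleSize_le n
      have hstep := logb_numConstructed_step h6 hm
      have ih := ih (bundleSize n) (by omega) (by omega)
      have hh : (h : ℝ) = ((bundleSize n : ℝ) - 1) / 2 := by rw [hm]; push_cast; ring
      rw [hh] at hstep
      have hm1 : (1 : ℝ) ≤ bundleSize n := by exact_mod_cast (by omega : 1 ≤ bundleSize n)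
      have hle' : (n : ℝ) ≤ 6 * bundleSize n + 11 := by exact_mod_cast hle
      have hge' : 6 * (bundleSize n : ℝ) ≤ n := by exact_mod_cast hge
      generalize (bundleSize n : ℝ) = m at *
      -- Passing from `m` to `n ≥ 6m` raises the logarithm by at least 2, which frees `8 * 6m * 2 =
      -- 96m`. This exceeds the linear losses: at most `50.6m` from `h4`, `30m` from `60h`, and
      -- `12m` from replacing `h` by `m / 2`.
      have h2 : Real.logb 2 (2 * m) + 2 ≤ Real.logb 2 (2 * n) := by
        have : Real.logb 2 (2 * m * 4) ≤ Real.logb 2 (2 * n) :=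
          Real.logb_le_logb_of_le (by norm_num) (by linarith) (by linarith)
        rw [Real.logb_mul (by linarith) (by norm_num)] at this
        have h4 : Real.logb 2 4 = 2 := by
          rw [show (4 : ℝ) = 2 ^ (2 : ℝ) by norm_num, Real.logb_rpow (by norm_num) (by norm_num)]
        rwa [h4] at this
      have h3 : 6 * m * (Real.logb 2 (2 * m) + 2) ≤ n * Real.logb 2 (2 * n) :=
        (mul_le_mul_of_nonneg_left h2 (by linarith)).trans
          (mul_le_mul_of_nonneg_right hge' (by linarith))
      have h4 : (n : ℝ) ^ 2 ≤ 36 * m ^ 2 + 253 * m := by nlinarith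
      have h5 := mul_le_mul_of_nonneg_left h4 hc'.le
      have h6 : c * m ≤ 0.2 * m := mul_le_mul_of_nonneg_right hc (by linarith)
      nlinarith

theorem rpow_le_numConstructed (n : ℕ) (hn : 2 ≤ n) :
    (2 : ℝ) ^ (c * (n : ℝ) ^ 2 - 16 * (n * Real.logb 2 n)) ≤ (numConstructed n : ℝ) := by
  have hT : (0 : ℝ) < numConstructed n := by exact_mod_cast numConstructed_pos n
  rw [← Real.le_logb_iff_rpow_le (by norm_num) hT]
  refine le_trans ?_ (logb_numConstructed_ge n (by omega))
  have hn2 : (2 : ℝ) ≤ n := by exact_mod_cast hn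
  have h1 : 1 ≤ Real.logb 2 n := by
    rw [Real.le_logb_iff_rpow_le (by norm_num) (by linarith)]; simpa using hn2
  rw [Real.logb_mul (by norm_num) (by linarith), Real.logb_self_eq_one (by norm_num)]
  nlinarith

end Hexagonal

/-! ### Arrangements up to homeomorphism of the plane. -/

namespace PseudolineArrangement

theorem Homeomorphic.refl {n : ℕ} (A : PseudolineArrangement n) : A.Homeomorphic A :=
  ⟨Homeomorph.refl _, 1, fun i => by simp⟩

theorem Homeomorphic.symm {n : ℕ} {A A' : PseudolineArrangement n} (h : A.Homeomorphic A') :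
    A'.Homeomorphic A := by
  obtain ⟨e, σ, he⟩ := h
  refine ⟨e.symm, σ.symm, fun i => ?_⟩
  have := he (σ.symm i)
  rw [Equiv.apply_symm_apply] at this
  rw [← this, Set.image_image]
  simp

/-- A homeomorphism preserves or reverses the order of the vertices on each pseudoline. -/
theorem Homeomorphic.exists_before_iff {n : ℕ} {A A' : PseudolineArrangement n}
    (h : A.Homeomorphic A') : ∃ (σ : Equiv.Perm (Fin n)) (ε : Fin n → Bool),
      ∀ i j k, i ≠ j → i ≠ k → (A.Before i j k ↔
        if ε i then A'.Before (σ i) (σ j) (σ k) else A'.Before (σ i) (σ k) (σ j)) := by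
  classical
  obtain ⟨e, σ, he⟩ := h
  -- `φ i` is the homeomorphism along pseudoline `i`, read in first coordinates; being continuous
  -- and injective, it is strictly monotone or strictly antitone.
  let φ : Fin n → ℝ → ℝ := fun i x => (e (x, A.curve i x)).1
  have hφ : ∀ i x, e (x, A.curve i x) = (φ i x, A'.curve (σ i) (φ i x)) := by
    intro i x
    have : e (x, A.curve i x) ∈ A'.pseudoline (σ i) := he i ▸ ⟨_, rfl, rfl⟩
    exact Prod.ext rfl this
  have hcont : ∀ i, Continuous (φ i) := fun i =>
    continuous_fst.comp (e.continuous.comp (continuous_id.prodMk (A.continuous_curve i)))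
  have hinj : ∀ i, Function.Injective (φ i) := by
    intro i x y hxy
    have : e (x, A.curve i x) = e (y, A.curve i y) := by rw [hφ, hφ, hxy]
    exact congrArg Prod.fst (e.injective this)
  have hcross : ∀ i j, i ≠ j → φ i (A.cross i j) = A'.cross (σ i) (σ j) := by
    intro i j hij
    refine (A'.curve_eq_iff (σ.injective.ne hij) _).1 ?_
    have h1 := hφ i (A.cross i j)
    have h2 := hφ j (A.cross i j)
    rw [(A.curve_eq_iff hij _).2 rfl, h2, Prod.mk.injEq] at h1
    rw [← h1.2, h1.1]
  refine ⟨σ, fun i => decide (StrictMono (φ i)), fun i j k hij hik => ?_⟩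
  have hij' := σ.injective.ne hij
  have hik' := σ.injective.ne hik
  simp only [decide_eq_true_eq]
  split_ifs with hm
  · rw [A.before_iff hij hik, A'.before_iff hij' hik', ← hcross i j hij, ← hcross i k hik,
      hm.lt_iff_lt]
  · have ha := ((hcont i).strictMono_of_inj (hinj i)).resolve_left hm
    rw [A.before_iff hij hik, A'.before_iff hik' hij', ← hcross i j hij, ← hcross i k hik,
      ha.lt_iff_gt]

theorem isomorphic_of_before_iff {n : ℕ} {A A₁ A₂ : PseudolineArrangement n}
    {σ : Equiv.Perm (Fin n)} {ε : Fin n → Bool}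
    (h₁ : ∀ i j k, i ≠ j → i ≠ k → (A.Before i j k ↔
      if ε i then A₁.Before (σ i) (σ j) (σ k) else A₁.Before (σ i) (σ k) (σ j)))
    (h₂ : ∀ i j k, i ≠ j → i ≠ k → (A.Before i j k ↔
      if ε i then A₂.Before (σ i) (σ j) (σ k) else A₂.Before (σ i) (σ k) (σ j))) :
    A₁.Isomorphic A₂ := by
  intro i j k hij hik
  obtain ⟨i, rfl⟩ := σ.surjective i
  obtain ⟨j, rfl⟩ := σ.surjective j
  obtain ⟨k, rfl⟩ := σ.surjective k
  have hij := ne_of_apply_ne σ hij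
  have hik := ne_of_apply_ne σ hik
  cases hε : ε i
  · have a := (h₁ i k j hik hij).symm.trans (h₂ i k j hik hij)
    simpa [hε] using a
  · have a := (h₁ i j k hij hik).symm.trans (h₂ i j k hij hik)
    simpa [hε] using a

end PseudolineArrangement

namespace Hexagonal

/-- A permutation and one direction bit per pseudoline determine the isomorphism class of a
homeomorphic image, so each homeomorphism class contains at most `n! * 2 ^ n` of them. -/
theorem exists_nonhomeomorphic (n : ℕ) : ∃ S : Finset (PseudolineArrangement n),
    (∀ A ∈ S, IsConstructed A) ∧ (∀ A ∈ S, ∀ A' ∈ S, A ≠ A' → ¬ A.Homeomorphic A') ∧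
    numConstructed n ≤ Nat.factorial n * 2 ^ n * S.card := by
  classical
  let R : Finset (PseudolineArrangement n) :=
    (constructedClasses n).toFinite.toFinset.image fun q => Quotient.out q
  have hR : R.card = numConstructed n := by
    have hinj : Function.Injective fun q : PseudolineArrangement.IsoClass n => Quotient.out q :=
      Quotient.out_injective
    refine (Finset.card_image_of_injective _ hinj).trans ?_
    exact (Set.ncard_eq_toFinset_card _ (constructedClasses n).toFinite).symm
  have hRc : ∀ A ∈ R, IsConstructed A := by
    intro A hA
    obtain ⟨q, hq, rfl⟩ := Finset.mem_image.1 hA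
    exact isConstructed_out ((Set.Finite.mem_toFinset _).1 hq)
  have hRi : ∀ A ∈ R, ∀ A' ∈ R, A.Isomorphic A' → A = A' := by
    intro A hA A' hA' h
    obtain ⟨q, hq, rfl⟩ := Finset.mem_image.1 hA
    obtain ⟨q', hq', rfl⟩ := Finset.mem_image.1 hA'
    have := (isoClass_out q).symm.trans
      ((PseudolineArrangement.isoClass_eq_iff.2 h).trans (isoClass_out q'))
    rw [this]
  -- A largest pairwise nonhomeomorphic set of representatives: by maximality, every representative
  -- is homeomorphic to a member of it.
  obtain ⟨S, hS, hmax⟩ := Finset.exists_max_image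
    (R.powerset.filter fun S => ∀ A ∈ S, ∀ A' ∈ S, A ≠ A' → ¬ A.Homeomorphic A') Finset.card
    ⟨∅, by simp⟩
  simp only [Finset.mem_filter, Finset.mem_powerset] at hS hmax
  have hex : ∀ A : PseudolineArrangement n, ∃ B, A ∈ R → B ∈ S ∧ B.Homeomorphic A := by
    intro A
    by_cases hA : A ∈ R
    · by_contra hc
      push Not at hc
      have hno : ∀ B ∈ S, ¬ B.Homeomorphic A := fun B hB => (hc B).2 hB
      have hAS : A ∉ S := fun h => hno A h (.refl A)
      have := hmax (insert A S) ⟨Finset.insert_subset hA hS.1, by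
        intro B hB B' hB' hne
        rcases Finset.mem_insert.1 hB with e | hBS <;>
          rcases Finset.mem_insert.1 hB' with e' | hBS'
        · exact absurd (e.trans e'.symm) hne
        · exact fun h => hno B' hBS' (e ▸ h.symm)
        · exact e' ▸ hno B hBS
        · exact hS.2 B hBS B' hBS' hne⟩
      rw [Finset.card_insert_of_notMem hAS] at this
      omega
    · exact ⟨A, fun h => absurd h hA⟩
  choose f hf using hex
  refine ⟨S, fun A hA => hRc A (hS.1 hA), hS.2, ?_⟩
  rw [← hR]
  refine Finset.card_le_mul_card_image_of_maps_to (f := f) (fun A hA => (hf A hA).1) _ ?_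
  intro B _
  have hdata : ∀ A : PseudolineArrangement n, ∃ x : Equiv.Perm (Fin n) × (Fin n → Bool),
      B.Homeomorphic A → ∀ i j k, i ≠ j → i ≠ k → (B.Before i j k ↔
        if x.2 i then A.Before (x.1 i) (x.1 j) (x.1 k)
        else A.Before (x.1 i) (x.1 k) (x.1 j)) := by
    intro A
    by_cases h : B.Homeomorphic A
    · obtain ⟨σ, ε, h'⟩ := h.exists_before_iff
      exact ⟨(σ, ε), fun _ => h'⟩
    · exact ⟨(1, fun _ => true), fun h' => absurd h' h⟩
  choose g hg using hdata
  have hcard : (Finset.univ : Finset (Equiv.Perm (Fin n) × (Fin n → Bool))).card =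
      Nat.factorial n * 2 ^ n := by
    rw [Finset.card_univ, Fintype.card_prod, Fintype.card_perm, Fintype.card_fin,
      Fintype.card_fun, Fintype.card_bool, Fintype.card_fin]
  rw [← hcard]
  refine Finset.card_le_card_of_injOn g (fun _ _ => Finset.mem_coe.2 (Finset.mem_univ _)) ?_
  intro A hA A' hA' heq
  simp only [Finset.coe_filter, Set.mem_ofPred_eq] at hA hA'
  have h1 := hg A (hA.2 ▸ (hf A hA.1).2)
  have h2 := hg A' (hA'.2 ▸ (hf A' hA'.1).2)
  rw [heq] at h1
  exact hRi A hA.1 A' hA'.1 (PseudolineArrangement.isomorphic_of_before_iff h1 h2)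

theorem numConstructed_le (n : ℕ) : numConstructed n ≤ numArrangements n :=
  Set.ncard_le_card _

theorem eventually_le_logb_numArrangements :
    ∀ᶠ n : ℕ in atTop, 0.1981 * (n : ℝ) ^ 2 ≤ Real.logb 2 (numArrangements n : ℝ) := by
  have hc := lt_c
  have hlim : Tendsto (fun n : ℕ => Real.logb 2 n / (n : ℝ)) atTop (nhds 0) := by
    have h1 : Tendsto (fun x : ℝ => Real.log x / x) atTop (nhds 0) :=
      Real.isLittleO_log_id_atTop.tendsto_div_nhds_zero
    have h2 := (h1.comp tendsto_natCast_atTop_atTop).div_const (Real.log 2)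
    simp only [zero_div] at h2
    refine h2.congr fun n => ?_
    simp only [Function.comp, Real.logb]
    ring
  have hev := hlim.eventually (gt_mem_nhds (show (0 : ℝ) < (c - 0.1981) / 16 by linarith))
  filter_upwards [hev, eventually_ge_atTop 2] with n hn hn2
  have hn0 : (0 : ℝ) < n := by exact_mod_cast (by omega : 0 < n)
  have hB : (numConstructed n : ℝ) ≤ numArrangements n := by exact_mod_cast numConstructed_le n
  have hT : (0 : ℝ) < numConstructed n := by exact_mod_cast numConstructed_pos n
  have h1 := (rpow_le_numConstructed n hn2).trans hB
  rw [← Real.le_logb_iff_rpow_le (by norm_num) (hT.trans_le hB)] at h1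
  refine le_trans ?_ h1
  rw [div_lt_iff₀ hn0] at hn
  nlinarith

theorem exists_nonhomeomorphic_rpow (n : ℕ) (hn : 2 ≤ n) :
    ∃ S : Finset (PseudolineArrangement n), (∀ A ∈ S, IsConstructed A) ∧
      (∀ A ∈ S, ∀ A' ∈ S, A ≠ A' → ¬ A.Homeomorphic A') ∧
      (2 : ℝ) ^ (c * (n : ℝ) ^ 2 - 18 * (n * Real.logb 2 n)) ≤ (S.card : ℝ) := by
  obtain ⟨S, h1, h2, h3⟩ := exists_nonhomeomorphic n
  refine ⟨S, h1, h2, ?_⟩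
  have hn2 : (2 : ℝ) ≤ n := by exact_mod_cast hn
  have hn0 : (0 : ℝ) < n := by linarith
  have hpow : ((n : ℝ)) ^ n = (2 : ℝ) ^ (n * Real.logb 2 n) := by
    rw [mul_comm, Real.rpow_mul (by norm_num), Real.rpow_logb (by norm_num) (by norm_num) hn0,
      Real.rpow_natCast]
  -- Both `n!` and `2 ^ n` are at most `n ^ n`, which raises the constant from 16 to 18.
  have hf : ((Nat.factorial n * 2 ^ n : ℕ) : ℝ) ≤ (2 : ℝ) ^ (2 * (n * Real.logb 2 n)) := by
    rw [two_mul, Real.rpow_add (by norm_num), ← hpow]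
    push_cast
    refine mul_le_mul ?_ (pow_le_pow_left₀ (by norm_num) hn2 n) (by positivity) (by positivity)
    exact_mod_cast Nat.factorial_le_pow n
  have h4 : (numConstructed n : ℝ) ≤ (2 : ℝ) ^ (2 * (n * Real.logb 2 n)) * S.card := by
    refine le_trans ?_ (mul_le_mul_of_nonneg_right hf (Nat.cast_nonneg _))
    exact_mod_cast h3
  have h5 := (rpow_le_numConstructed n hn).trans h4
  rw [show c * (n : ℝ) ^ 2 - 16 * (n * Real.logb 2 n) = 2 * (n * Real.logb 2 n) +
    (c * (n : ℝ) ^ 2 - 18 * (n * Real.logb 2 n)) by ring, Real.rpow_add (by norm_num)] at h5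
  exact le_of_mul_le_mul_left h5 (by positivity)

end Hexagonal

theorem mainTheorem2 :
    (0.1981 : ℝ) < Hexagonal.c ∧
    (∃ K : ℝ, ∀ n : ℕ, 2 ≤ n →
      (2 : ℝ) ^ (Hexagonal.c * (n : ℝ) ^ 2 - K * (n * Real.logb 2 n))
        ≤ (Hexagonal.numConstructed n : ℝ)) ∧
    (∀ n : ℕ, Hexagonal.numConstructed n ≤ numArrangements n) ∧
    (∀ᶠ n : ℕ in atTop, 0.1981 * (n : ℝ) ^ 2 ≤ Real.logb 2 (numArrangements n : ℝ)) ∧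
    (∃ K : ℝ, ∀ n : ℕ, 2 ≤ n → ∃ S : Finset (PseudolineArrangement n),
      (∀ A ∈ S, Hexagonal.IsConstructed A) ∧
      (∀ A ∈ S, ∀ A' ∈ S, A ≠ A' → ¬ A.Homeomorphic A') ∧
      (2 : ℝ) ^ (Hexagonal.c * (n : ℝ) ^ 2 - K * (n * Real.logb 2 n)) ≤ (S.card : ℝ)) :=
  ⟨Hexagonal.lt_c, ⟨16, Hexagonal.rpow_le_numConstructed⟩, Hexagonal.numConstructed_le,
    Hexagonal.eventually_le_logb_numArrangements, ⟨18, Hexagonal.exists_nonhomeomorphic_rpow⟩⟩
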